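/- Let $k$ be an algebraically closed field of characteristic zero, and let $U$ and $A$ be pointed Hopf algebras over $k$ (every simple subcoalgebra is one-dimensional) whose coradicals $U_0$, $A_0$ (the sums of the simple subcoalgebras) are commutative. Call an element $a$ of a Hopf algebra $B$ skew primitive if $\Delta(a)=a\otimes g+h\otimes a$ for some group-like $g,h\in B$, and say that a skew primitive $a$ is of finite type (of finite rank) if the sub-Hopf algebra of $B$ generated by $B_0\cup\{a\}$ is a free left $B_0$-module of finite rank. Suppose that $U$ and $A$ are generated as algebras by their skew primitive elements of finite type. Let $\tau:U\otimes A\to k$ be a convolution invertible linear form such that for all $u,u'\in U$ and $a,a'\in A$: (A.1) $\tau(u,aa')=\tau(u_{(2)},a)\,\tau(u_{(1)},a')$; (A.2) $\tau(1,a)=\epsilon(a)$; (A.3) $\tau(uu',a)=\tau(u,a_{(1)})\,\tau(u',a_{(2)})$; (A.4) $\tau(u,1)=\epsilon(u)$. Let $\sigma(u\otimes a,u'\otimes a')=\epsilon(u)\tau(u',a)\epsilon(a')$, a 2-cocycle for the bialgebra $U\otimes A$, and let $H=(U\otimes A)^\sigma$ be the algebra on the vector space $U\otimes A$ with product $x\cdot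 y=\sigma(x_{(1)},y_{(1)})\,x_{(2)}y_{(2)}\,\sigma^{-1}(x_{(3)},y_{(3)})$. The maps $u\mapsto u\otimes 1$ and $a\mapsto 1\otimes a$ are algebra maps $U\to H$ and $A\to H$, by which $H$-modules are regarded as $U$-modules and as $A$-modules. Let ${}_H\underline{\mathcal M}$ be the category of those left $H$-modules $M$ which are generated by some one-dimensional $A$-submodule and have a $U$-submodule $N$ of codimension one such that $(0)$ is the only $H$-submodule of $M$ contained in $N$; its morphisms are the $H$-module maps. Let $[{}_H\underline{\mathcal M}]$ be the set of isomorphism classes of its objects. Let $\mathrm{Alg}(U,k)$, $\mathrm{Alg}(A,k)$ be the sets of algebra maps to $k$. For $\rho\in\mathrm{Alg}(U,k)$ and $\chi\in\mathrm{Alg}(A,k)$ let $U_\chi=H\otimes_A k_\chi$, where $k_\chi$ is $k$ with $A$ acting through $\chi$; identify $U_\chi$ with the vector space $U$ by $(u\otimes a)\otimes_A 1\mapsto \chi(a)u$, so that $(u\otimes a)\cdot_\chi u'=u\,\big((\mathrm{id}_U\otimes\chi)((1\otimes a)(u'\otimes 1))\big)$. Let $I(\rho,\chi)$ be the sum of all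 $H$-submodules of $U_\chi$ contained in $\mathrm{Ker}\,\rho$, and let $L(\rho,\chi)=U_\chi/I(\rho,\chi)$. Then $\mathrm{Alg}(U,k)$ and $\mathrm{Alg}(A,k)$ are abelian groups under convolution, and: a) every $L(\rho,\chi)$ is an object of ${}_H\underline{\mathcal M}$, and the map $\mathrm{Alg}(U,k)\times\mathrm{Alg}(A,k)\to[{}_H\underline{\mathcal M}]$, $(\rho,\chi)\mapsto[L(\rho,\chi)]$, is bijective. b) Every object of ${}_H\underline{\mathcal M}$ has a unique one-dimensional $A$-submodule and a unique codimension one $U$-submodule. c) Suppose that the finite-dimensional irreducible left $U$-modules and the finite-dimensional irreducible left $A$-modules are one-dimensional. Then the finite-dimensional irreducible left $H$-modules are exactly the finite-dimensional objects of ${}_H\underline{\mathcal M}$. -/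

import Mathlib

open scoped TensorProduct

universe u v w

noncomputable section

/-! ### Subcoalgebras, the coradical, pointedness -/

namespace HopfSub

variable (k : Type*) [Field k] {A : Type*}

/-- A subspace `C` is a subcoalgebra if `Δ(C) ⊆ C ⊗ C`. -/
def IsSubcoalgebra [AddCommGroup A] [Module k A] [Coalgebra k A] (C : Submodule k A) : Prop :=
  ∀ c ∈ C, Coalgebra.comul (R := k) c ∈ LinearMap.range (TensorProduct.mapIncl C C)

/-- A simple subcoalgebra: nonzero, with no subcoalgebras except `0` and itself. -/
structure IsSimpleSubcoalgebra [AddCommGroup A] [Module k A] [Coalgebra k A]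
    (C : Submodule k A) : Prop where
  isSubcoalgebra : IsSubcoalgebra k C
  ne_bot : C ≠ ⊥
  eq_bot_or_eq : ∀ D : Submodule k A, IsSubcoalgebra k D → D ≤ C → D = ⊥ ∨ D = C

/-- The coradical: the sum of all simple subcoalgebras. -/
def coradical (A : Type*) [AddCommGroup A] [Module k A] [Coalgebra k A] : Submodule k A :=
  sSup {C | IsSimpleSubcoalgebra k C}

/-- A coalgebra is pointed if all its simple subcoalgebras are one-dimensional. -/
def IsPointed (A : Type*) [AddCommGroup A] [Module k A] [Coalgebra k A] : Prop :=
  ∀ C : Submodule k A, IsSimpleSubcoalgebra k C → Module.finrank k C = 1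

/-- Any two elements of the coradical commute. -/
def HasCommutativeCoradical (A : Type*) [Ring A] [Bialgebra k A] : Prop :=
  ∀ x ∈ coradical k A, ∀ y ∈ coradical k A, x * y = y * x

variable [Ring A] [HopfAlgebra k A]

/-- A sub-Hopf algebra: a subalgebra which is a subcoalgebra and is stable under the antipode. -/
structure IsSubHopfAlgebra (E : Subalgebra k A) : Prop where
  isSubcoalgebra : IsSubcoalgebra k (Subalgebra.toSubmodule E)
  antipode_mem : ∀ x ∈ E, HopfAlgebra.antipode k x ∈ E

/-- The sub-Hopf algebra generated by a set: the intersection of all sub-Hopf algebras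
containing it. -/
def hopfClosure (s : Set A) : Subalgebra k A :=
  sInf {E | IsSubHopfAlgebra k E ∧ s ⊆ E}

/-- `a` is skew primitive: `Δ(a) = a ⊗ g + h ⊗ a` for some group-like elements `g`, `h`. -/
def IsSkewPrimitive (a : A) : Prop :=
  ∃ g h : A, IsGroupLikeElem k g ∧ IsGroupLikeElem k h ∧
    Coalgebra.comul (R := k) a = a ⊗ₜ[k] g + h ⊗ₜ[k] a

/-- The coradical as a subalgebra. For a pointed Hopf algebra the coradical is closed under
multiplication, so that taking the generated subalgebra adds nothing. -/
def coradicalSubalgebra (A : Type*) [Ring A] [HopfAlgebra k A] : Subalgebra k A :=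
  Algebra.adjoin k (coradical k A : Set A)

/-- The sub-Hopf algebra generated by the coradical and `a`, as a left module over the
coradical. -/
def hopfExtension (a : A) : Submodule (coradicalSubalgebra k A) A where
  carrier := hopfClosure k ((coradical k A : Set A) ∪ {a})
  add_mem' := add_mem
  zero_mem' := zero_mem _
  smul_mem' b x hx := by
    refine mul_mem ?_ hx
    have h : coradicalSubalgebra k A ≤ hopfClosure k ((coradical k A : Set A) ∪ {a}) :=
      le_sInf fun E hE => Algebra.adjoin_le (Set.subset_union_left.trans hE.2)
    exact h b.2

/-- `a` is of finite type (finite rank): the sub-Hopf algebra generated by the coradical and `a`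
is a free left module of finite rank over the coradical. -/
def IsOfFiniteType (a : A) : Prop :=
  Module.Free (coradicalSubalgebra k A) (hopfExtension k a) ∧
    Module.Finite (coradicalSubalgebra k A) (hopfExtension k a)

/-- `A` is generated as an algebra by its skew primitive elements of finite type. -/
def GeneratedByFiniteTypeSkewPrimitives (A : Type*) [Ring A] [HopfAlgebra k A] : Prop :=
  Algebra.adjoin k {a : A | IsSkewPrimitive k a ∧ IsOfFiniteType k a} = ⊤

end HopfSub

/-! ### Twisting the multiplication of a bialgebra by a 2-cocycle -/

namespace CocycleTwist

open WithConv

variable {k B C : Type*} [Field k] [Ring B] [Bialgebra k B]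
  [AddCommGroup C] [Module k C] [Coalgebra k C]

/-- A linear form regarded as a map with values in an algebra `D`. -/
def scal (D : Type*) [Ring D] [Algebra k D] (f : WithConv (C →ₗ[k] k)) : WithConv (C →ₗ[k] D) :=
  toConv (Algebra.linearMap k D ∘ₗ f.ofConv)

/-- The twisted multiplication
`x ⊗ y ↦ σ(x₍₁₎, y₍₁₎) x₍₂₎ y₍₂₎ σ⁻¹(x₍₃₎, y₍₃₎)`, a threefold convolution product of maps
`B ⊗ B → B`. -/
def twistMul (σ : (WithConv (B ⊗[k] B →ₗ[k] k))ˣ) : B ⊗[k] B →ₗ[k] B :=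
  (scal B σ.val * toConv (LinearMap.mul' k B) * scal B σ⁻¹.val).ofConv

/-- The 2-cocycle condition
`σ(x₍₁₎, y₍₁₎) σ(x₍₂₎ y₍₂₎, z) = σ(y₍₁₎, z₍₁₎) σ(x, y₍₂₎ z₍₂₎)`,
as an equality of convolution products of linear forms on `(B ⊗ B) ⊗ B`. -/
def IsTwoCocycle (σ : B ⊗[k] B →ₗ[k] k) : Prop :=
  toConv (LinearMap.mul' k k ∘ₗ TensorProduct.map σ (Coalgebra.counit (R := k) (A := B))) *
      toConv (σ ∘ₗ TensorProduct.map (LinearMap.mul' k B) LinearMap.id) =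
    toConv (LinearMap.mul' k k ∘ₗ TensorProduct.map (Coalgebra.counit (R := k) (A := B)) σ ∘ₗ
        (TensorProduct.assoc k B B B).toLinearMap) *
      toConv (σ ∘ₗ TensorProduct.map LinearMap.id (LinearMap.mul' k B) ∘ₗ
        (TensorProduct.assoc k B B B).toLinearMap)

/-! #### Associativity of the twisted multiplication -/

/-- Precomposition with a coalgebra map is multiplicative for convolution. -/
def pull {D : Type*} [AddCommGroup D] [Module k D] [Coalgebra k D] (E : Type*) [Ring E]
    [Algebra k E] (h : C →ₗc[k] D) :
    WithConv (D →ₗ[k] E) →* WithConv (C →ₗ[k] E) where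
  toFun f := toConv (f.ofConv ∘ₗ h.toLinearMap)
  map_one' := by
    ext c
    simp
  map_mul' f g := by
    rw [LinearMap.convMul_comp_coalgHom_distrib]

theorem scal_mul (D : Type*) [Ring D] [Algebra k D] (f g : WithConv (C →ₗ[k] k)) :
    scal D (f * g) = scal D f * scal D g := by
  have h := LinearMap.algHom_comp_convMul_distrib (Algebra.ofId k D) f g
  exact congrArg toConv h

theorem scal_one (D : Type*) [Ring D] [Algebra k D] :
    scal D (1 : WithConv (C →ₗ[k] k)) = 1 := by
  ext c
  simp [scal]

theorem comp_scal_mul {D E : Type*} [Ring D] [Algebra k D] [Ring E] [Algebra k E]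
    (Φ : D →ₗ[k] E) (f : WithConv (C →ₗ[k] k)) (F : WithConv (C →ₗ[k] D)) :
    toConv (Φ ∘ₗ (scal D f * F).ofConv) = scal E f * toConv (Φ ∘ₗ F.ofConv) := by
  ext c
  change Φ ((scal D f * F) c) = _
  rw [(Coalgebra.Repr.arbitrary k c).convMul_apply, (Coalgebra.Repr.arbitrary k c).convMul_apply]
  simp [scal, ← Algebra.smul_def]

theorem comp_mul_scal {D E : Type*} [Ring D] [Algebra k D] [Ring E] [Algebra k E]
    (Φ : D →ₗ[k] E) (f : WithConv (C →ₗ[k] k)) (F : WithConv (C →ₗ[k] D)) :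
    toConv (Φ ∘ₗ (F * scal D f).ofConv) = toConv (Φ ∘ₗ F.ofConv) * scal E f := by
  ext c
  change Φ ((F * scal D f) c) = _
  rw [(Coalgebra.Repr.arbitrary k c).convMul_apply, (Coalgebra.Repr.arbitrary k c).convMul_apply]
  simp [scal, ← Algebra.smul_def, ← Algebra.commutes]

/-- Restricting the twisted multiplication along a coalgebra map. -/
theorem twistMul_comp (σ : (WithConv (B ⊗[k] B →ₗ[k] k))ˣ) (h : C →ₗc[k] B ⊗[k] B) :
    toConv (twistMul σ ∘ₗ h.toLinearMap) =
      scal B (Units.map (pull k h) σ).val * toConv (LinearMap.mul' k B ∘ₗ h.toLinearMap) *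
        scal B ((Units.map (pull k h) σ)⁻¹).val := by
  exact (map_mul (pull B h) (scal B σ.val * toConv (LinearMap.mul' k B)) (scal B σ⁻¹.val)).trans
    (congrArg (· * _) (map_mul (pull B h) (scal B σ.val) (toConv (LinearMap.mul' k B))))

variable (k B) in
/-- The coalgebra map `x ⊗ y ⊗ z ↦ (x ⊗ y) ε(z)`. -/
def p12 : (B ⊗[k] B) ⊗[k] B →ₗc[k] B ⊗[k] B :=
  (Coalgebra.TensorProduct.rid k k (B ⊗[k] B)).toCoalgHom.comp
    (Coalgebra.TensorProduct.map (CoalgHom.id k _) (Coalgebra.counitCoalgHom k B))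

variable (k B) in
/-- The coalgebra map `x ⊗ y ⊗ z ↦ ε(x) (y ⊗ z)`. -/
def p23 : (B ⊗[k] B) ⊗[k] B →ₗc[k] B ⊗[k] B :=
  ((Coalgebra.TensorProduct.lid k (B ⊗[k] B)).toCoalgHom.comp
    (Coalgebra.TensorProduct.map (Coalgebra.counitCoalgHom k B) (CoalgHom.id k _))).comp
    (Coalgebra.TensorProduct.assoc k k B B B).toCoalgHom

variable (k B) in
/-- The coalgebra map `x ⊗ y ⊗ z ↦ xy ⊗ z`. -/
def m12 : (B ⊗[k] B) ⊗[k] B →ₗc[k] B ⊗[k] B :=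
  Coalgebra.TensorProduct.map (Bialgebra.mulCoalgHom k B) (CoalgHom.id k _)

variable (k B) in
/-- The coalgebra map `x ⊗ y ⊗ z ↦ x ⊗ yz`. -/
def m23 : (B ⊗[k] B) ⊗[k] B →ₗc[k] B ⊗[k] B :=
  (Coalgebra.TensorProduct.map (CoalgHom.id k _) (Bialgebra.mulCoalgHom k B)).comp
    (Coalgebra.TensorProduct.assoc k k B B B).toCoalgHom

theorem isTwoCocycle_iff (σ : (WithConv (B ⊗[k] B →ₗ[k] k))ˣ) :
    IsTwoCocycle σ.val.ofConv ↔
      Units.map (pull k (p12 k B)) σ * Units.map (pull k (m12 k B)) σ =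
        Units.map (pull k (p23 k B)) σ * Units.map (pull k (m23 k B)) σ := by
  rw [Units.ext_iff]
  unfold IsTwoCocycle
  have h1 : toConv (LinearMap.mul' k k ∘ₗ
      TensorProduct.map σ.val.ofConv (Coalgebra.counit (R := k) (A := B))) =
      (Units.map (pull k (p12 k B)) σ).val := by
    apply WithConv.ext
    apply TensorProduct.ext_threefold
    intro x y z
    change σ.val.ofConv (x ⊗ₜ y) * Coalgebra.counit (R := k) z =
      σ.val.ofConv (Coalgebra.counit (R := k) z • (x ⊗ₜ y))
    rw [LinearMap.map_smul, smul_eq_mul, mul_comm]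
  have h2 : toConv (LinearMap.mul' k k ∘ₗ
      TensorProduct.map (Coalgebra.counit (R := k) (A := B)) σ.val.ofConv ∘ₗ
        (TensorProduct.assoc k B B B).toLinearMap) =
      (Units.map (pull k (p23 k B)) σ).val := by
    apply WithConv.ext
    apply TensorProduct.ext_threefold
    intro x y z
    change Coalgebra.counit (R := k) x * σ.val.ofConv (y ⊗ₜ z) =
      σ.val.ofConv (Coalgebra.counit (R := k) x • (y ⊗ₜ z))
    rw [LinearMap.map_smul, smul_eq_mul]
  rw [h1, h2]
  rfl

theorem twistMul_rTensor (σ : (WithConv (B ⊗[k] B →ₗ[k] k))ˣ) :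
    toConv (TensorProduct.map (twistMul σ) (LinearMap.id : B →ₗ[k] B)) =
      scal (B ⊗[k] B) (Units.map (pull k (p12 k B)) σ).val * toConv (m12 k B).toLinearMap *
        scal (B ⊗[k] B) ((Units.map (pull k (p12 k B)) σ)⁻¹).val := by
  have hs : ∀ f : WithConv (B ⊗[k] B →ₗ[k] k), scal (B ⊗[k] B) (pull k (p12 k B) f) =
      toConv (TensorProduct.map (scal B f).ofConv (1 : WithConv (B →ₗ[k] B)).ofConv) := by
    intro f
    apply WithConv.ext
    apply TensorProduct.ext_threefold
    intro x y z
    change algebraMap k (B ⊗[k] B) (f.ofConv (Coalgebra.counit (R := k) z • (x ⊗ₜ y))) =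
      algebraMap k B (f.ofConv (x ⊗ₜ y)) ⊗ₜ algebraMap k B (Coalgebra.counit (R := k) z)
    rw [LinearMap.map_smul, smul_eq_mul, Algebra.algebraMap_eq_smul_one,
      Algebra.algebraMap_eq_smul_one, Algebra.algebraMap_eq_smul_one,
      TensorProduct.smul_tmul_smul, Algebra.TensorProduct.one_def, mul_comm]
  change _ = scal (B ⊗[k] B) (pull k (p12 k B) σ.val) * toConv (m12 k B).toLinearMap *
        scal (B ⊗[k] B) (pull k (p12 k B) σ⁻¹.val)
  rw [hs, hs]
  have h2 : toConv (m12 k B).toLinearMap =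
      toConv (TensorProduct.map (toConv (LinearMap.mul' k B)).ofConv
        (toConv (LinearMap.id : B →ₗ[k] B)).ofConv) := rfl
  rw [h2, TensorProduct.map_convMul_map, TensorProduct.map_convMul_map, one_mul, mul_one]
  rfl

theorem twistMul_lTensor (σ : (WithConv (B ⊗[k] B →ₗ[k] k))ˣ) :
    toConv (TensorProduct.map (LinearMap.id : B →ₗ[k] B) (twistMul σ) ∘ₗ
        (TensorProduct.assoc k B B B).toLinearMap) =
      scal (B ⊗[k] B) (Units.map (pull k (p23 k B)) σ).val * toConv (m23 k B).toLinearMap *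
        scal (B ⊗[k] B) ((Units.map (pull k (p23 k B)) σ)⁻¹).val := by
  let α : (B ⊗[k] B) ⊗[k] B →ₗc[k] B ⊗[k] (B ⊗[k] B) :=
    (Coalgebra.TensorProduct.assoc k k B B B).toCoalgHom
  have hs : ∀ f : WithConv (B ⊗[k] B →ₗ[k] k), scal (B ⊗[k] B) (pull k (p23 k B) f) =
      pull (B ⊗[k] B) α
        (toConv (TensorProduct.map (1 : WithConv (B →ₗ[k] B)).ofConv (scal B f).ofConv)) := by
    intro f
    apply WithConv.ext
    apply TensorProduct.ext_threefold
    intro x y z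
    change algebraMap k (B ⊗[k] B) (f.ofConv (Coalgebra.counit (R := k) x • (y ⊗ₜ z))) =
      algebraMap k B (Coalgebra.counit (R := k) x) ⊗ₜ algebraMap k B (f.ofConv (y ⊗ₜ z))
    rw [LinearMap.map_smul, smul_eq_mul, Algebra.algebraMap_eq_smul_one,
      Algebra.algebraMap_eq_smul_one, Algebra.algebraMap_eq_smul_one,
      TensorProduct.smul_tmul_smul, Algebra.TensorProduct.one_def]
  change _ = scal (B ⊗[k] B) (pull k (p23 k B) σ.val) * toConv (m23 k B).toLinearMap *
        scal (B ⊗[k] B) (pull k (p23 k B) σ⁻¹.val)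
  rw [hs, hs]
  have h2 : toConv (m23 k B).toLinearMap =
      pull (B ⊗[k] B) α (toConv (TensorProduct.map
        (toConv (LinearMap.id : B →ₗ[k] B)).ofConv (toConv (LinearMap.mul' k B)).ofConv)) := rfl
  rw [h2, ← map_mul, ← map_mul, TensorProduct.map_convMul_map, TensorProduct.map_convMul_map,
    one_mul, mul_one]
  rfl

/-- The multiplication twisted by a 2-cocycle is associative. -/
theorem twistMul_assoc (σ : (WithConv (B ⊗[k] B →ₗ[k] k))ˣ) (hσ : IsTwoCocycle σ.val.ofConv)
    (x y z : B) :
    twistMul σ (twistMul σ (x ⊗ₜ[k] y) ⊗ₜ[k] z) =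
      twistMul σ (x ⊗ₜ[k] twistMul σ (y ⊗ₜ[k] z)) := by
  rw [isTwoCocycle_iff] at hσ
  have key : toConv (twistMul σ ∘ₗ TensorProduct.map (twistMul σ) (LinearMap.id : B →ₗ[k] B)) =
      toConv (twistMul σ ∘ₗ TensorProduct.map (LinearMap.id : B →ₗ[k] B) (twistMul σ) ∘ₗ
        (TensorProduct.assoc k B B B).toLinearMap) := by
    have e1 := congrArg (fun F => toConv (twistMul σ ∘ₗ F.ofConv)) (twistMul_rTensor σ)
    have e2 := congrArg (fun F => toConv (twistMul σ ∘ₗ F.ofConv)) (twistMul_lTensor σ)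
    simp only [comp_mul_scal, comp_scal_mul, twistMul_comp] at e1 e2
    rw [e1, e2]
    have hm : LinearMap.mul' k B ∘ₗ (m12 k B).toLinearMap =
        LinearMap.mul' k B ∘ₗ (m23 k B).toLinearMap := by
      apply TensorProduct.ext_threefold
      intro x y z
      simp [m12, m23, mul_assoc]
    have hinv := congrArg (fun s => s⁻¹) hσ
    simp only [mul_inv_rev] at hinv
    have a1 := congrArg (fun s : (WithConv ((B ⊗[k] B) ⊗[k] B →ₗ[k] k))ˣ => scal B s.val) hσ
    have a2 := congrArg (fun s : (WithConv ((B ⊗[k] B) ⊗[k] B →ₗ[k] k))ˣ => scal B s.val) hinv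
    simp only [Units.val_mul, scal_mul] at a1 a2
    rw [hm]
    simp only [← mul_assoc]
    rw [a1]
    simp only [mul_assoc]
    rw [a2]
  exact DFunLike.congr_fun (congrArg WithConv.ofConv key) ((x ⊗ₜ[k] y) ⊗ₜ[k] z)

end CocycleTwist

/-! ### The bialgebra pairings and the algebra `H = (U ⊗ A)^σ` -/

/-- A convolution invertible linear form `τ : U ⊗ A → k` with
* `τ(u, aa') = τ(u₍₂₎, a) τ(u₍₁₎, a')`,
* `τ(1, a) = ε(a)`,
* `τ(uu', a) = τ(u, a₍₁₎) τ(u', a₍₂₎)`,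
* `τ(u, 1) = ε(u)`.

Here `Coalgebra.Repr.arbitrary k x` is a presentation `Δ(x) = ∑ i, left i ⊗ right i`. -/
structure SkewPairing (k U A : Type*) [Field k] [Ring U] [Bialgebra k U] [Ring A]
    [Bialgebra k A] where
  form : U ⊗[k] A →ₗ[k] k
  isUnit_form : IsUnit (WithConv.toConv form)
  form_mul_right : ∀ (u : U) (a a' : A), form (u ⊗ₜ[k] (a * a')) =
    ∑ i ∈ (Coalgebra.Repr.arbitrary k u).index,
      form ((Coalgebra.Repr.arbitrary k u).right i ⊗ₜ[k] a) *
        form ((Coalgebra.Repr.arbitrary k u).left i ⊗ₜ[k] a')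
  form_one_left : ∀ a : A, form (1 ⊗ₜ[k] a) = Coalgebra.counit (R := k) a
  form_mul_left : ∀ (u u' : U) (a : A), form ((u * u') ⊗ₜ[k] a) =
    ∑ i ∈ (Coalgebra.Repr.arbitrary k a).index,
      form (u ⊗ₜ[k] (Coalgebra.Repr.arbitrary k a).left i) *
        form (u' ⊗ₜ[k] (Coalgebra.Repr.arbitrary k a).right i)
  form_one_right : ∀ u : U, form (u ⊗ₜ[k] 1) = Coalgebra.counit (R := k) u

namespace SkewPairing

open WithConv CocycleTwist

variable {k U A : Type*} [Field k] [Ring U] [Bialgebra k U] [Ring A] [Bialgebra k A]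

variable (k U A) in
/-- The coalgebra map `u ⊗ a ↦ ε(u) a`. -/
def projA : U ⊗[k] A →ₗc[k] A :=
  (Coalgebra.TensorProduct.lid k A).toCoalgHom.comp
    (Coalgebra.TensorProduct.map (Coalgebra.counitCoalgHom k U) (CoalgHom.id k A))

variable (k U A) in
/-- The coalgebra map `u ⊗ a ↦ ε(a) u`. -/
def projU : U ⊗[k] A →ₗc[k] U :=
  (Coalgebra.TensorProduct.rid k k U).toCoalgHom.comp
    (Coalgebra.TensorProduct.map (CoalgHom.id k U) (Coalgebra.counitCoalgHom k A))

variable (k U A) in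
/-- The twist map `a ⊗ u ↦ u ⊗ a` as a coalgebra map. -/
def swap : A ⊗[k] U →ₗc[k] U ⊗[k] A :=
  ((Bialgebra.TensorProduct.comm k A U : A ⊗[k] U ≃ₐc[k] U ⊗[k] A) :
    A ⊗[k] U →ₗc[k] U ⊗[k] A)

variable (k U A) in
/-- The coalgebra map `(u ⊗ a) ⊗ (u' ⊗ a') ↦ ε(u) ε(a') u' ⊗ a`. -/
def proj : (U ⊗[k] A) ⊗[k] (U ⊗[k] A) →ₗc[k] U ⊗[k] A :=
  (swap k U A).comp (Coalgebra.TensorProduct.map (projA k U A) (projU k U A))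

theorem proj_tmul (u u' : U) (a a' : A) :
    proj k U A ((u ⊗ₜ a) ⊗ₜ (u' ⊗ₜ a')) =
      (Coalgebra.counit (R := k) a' • u') ⊗ₜ[k] (Coalgebra.counit (R := k) u • a) := rfl

/-- The linear form `σ(u ⊗ a, u' ⊗ a') = ε(u) τ(u', a) ε(a')`, together with its convolution
inverse. -/
def sigma (τ : SkewPairing k U A) : (WithConv ((U ⊗[k] A) ⊗[k] (U ⊗[k] A) →ₗ[k] k))ˣ :=
  Units.map (pull k (proj k U A)) τ.isUnit_form.unit

theorem sigma_tmul (τ : SkewPairing k U A) (u u' : U) (a a' : A) :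
    τ.sigma.val.ofConv ((u ⊗ₜ a) ⊗ₜ (u' ⊗ₜ a')) =
      Coalgebra.counit (R := k) u * τ.form (u' ⊗ₜ a) * Coalgebra.counit (R := k) a' := by
  change τ.form (proj k U A ((u ⊗ₜ a) ⊗ₜ (u' ⊗ₜ a'))) = _
  rw [proj_tmul, TensorProduct.smul_tmul_smul, map_smul, smul_eq_mul]
  ring

/-! #### The form `σ` is a 2-cocycle -/

theorem sum_counit_mul {M : Type*} [AddCommGroup M] [Module k M] [Coalgebra k M] (f : M →ₗ[k] k)
    (x : M) : ∑ i ∈ (Coalgebra.Repr.arbitrary k x).index,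
      Coalgebra.counit (R := k) ((Coalgebra.Repr.arbitrary k x).left i) *
        f ((Coalgebra.Repr.arbitrary k x).right i) = f x := by
  conv_rhs => rw [← Coalgebra.sum_counit_smul (Coalgebra.Repr.arbitrary k x)]
  simp

theorem sum_mul_counit {M : Type*} [AddCommGroup M] [Module k M] [Coalgebra k M] (f : M →ₗ[k] k)
    (x : M) : ∑ i ∈ (Coalgebra.Repr.arbitrary k x).index,
      f ((Coalgebra.Repr.arbitrary k x).left i) *
        Coalgebra.counit (R := k) ((Coalgebra.Repr.arbitrary k x).right i) = f x := by
  have h := congrArg (TensorProduct.lift ((LinearMap.mul k k).compl₁₂ f LinearMap.id))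
    (Coalgebra.sum_tmul_counit_eq (Coalgebra.Repr.arbitrary k x))
  simpa only [map_sum, TensorProduct.lift.tmul, LinearMap.compl₁₂_apply, LinearMap.mul_apply',
    LinearMap.id_apply, mul_one] using h

/-- The form `a ⊗ u ↦ τ(u, a)`. -/
def flipForm (τ : SkewPairing k U A) : WithConv (A ⊗[k] U →ₗ[k] k) :=
  pull k (swap k U A) (toConv τ.form)

theorem flipForm_tmul (τ : SkewPairing k U A) (a : A) (u : U) :
    τ.flipForm.ofConv (a ⊗ₜ u) = τ.form (u ⊗ₜ a) := rfl

theorem pull_mul_right (τ : SkewPairing k U A) :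
    pull k (Coalgebra.TensorProduct.map (Bialgebra.mulCoalgHom k A) (CoalgHom.id k U))
        τ.flipForm =
      pull k (Coalgebra.TensorProduct.map (projA k A A) (CoalgHom.id k U)) τ.flipForm *
        pull k (Coalgebra.TensorProduct.map (projU k A A) (CoalgHom.id k U)) τ.flipForm := by
  apply WithConv.ext
  apply TensorProduct.ext_threefold
  intro a b w
  let ra := Coalgebra.Repr.arbitrary k a
  let rb := Coalgebra.Repr.arbitrary k b
  let rw' := Coalgebra.Repr.arbitrary k w
  refine Eq.trans ?_ (((ra.tmul rb).tmul rw').convMul_apply _ _).symm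
  change τ.form (w ⊗ₜ (a * b)) = ∑ p ∈ (ra.index ×ˢ rb.index) ×ˢ rw'.index,
    τ.form (rw'.left p.2 ⊗ₜ (Coalgebra.counit (R := k) (ra.left p.1.1) • rb.left p.1.2)) *
    τ.form (rw'.right p.2 ⊗ₜ (Coalgebra.counit (R := k) (rb.right p.1.2) • ra.right p.1.1))
  rw [form_mul_right, Finset.sum_product_right]
  refine Finset.sum_congr rfl fun l _ => ?_
  rw [Finset.sum_product]
  have h1 := sum_counit_mul (τ.form ∘ₗ TensorProduct.mk k U A (rw'.right l)) a
  have h2 := sum_mul_counit (τ.form ∘ₗ TensorProduct.mk k U A (rw'.left l)) b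
  change τ.form (rw'.right l ⊗ₜ a) * τ.form (rw'.left l ⊗ₜ b) = _
  change _ = τ.form (rw'.right l ⊗ₜ a) at h1
  change _ = τ.form (rw'.left l ⊗ₜ b) at h2
  rw [← h1, ← h2, Finset.sum_mul_sum]
  refine Finset.sum_congr rfl fun i _ => Finset.sum_congr rfl fun j _ => ?_
  simp only [TensorProduct.tmul_smul, map_smul, smul_eq_mul, LinearMap.comp_apply,
    TensorProduct.mk_apply]
  ring

theorem pull_mul_left (τ : SkewPairing k U A) :
    pull k (Coalgebra.TensorProduct.map (CoalgHom.id k A) (Bialgebra.mulCoalgHom k U))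
        τ.flipForm =
      pull k (Coalgebra.TensorProduct.map (CoalgHom.id k A) (projU k U U)) τ.flipForm *
        pull k (Coalgebra.TensorProduct.map (CoalgHom.id k A) (projA k U U)) τ.flipForm := by
  apply WithConv.ext
  apply TensorProduct.ext
  ext a : 1
  apply TensorProduct.ext'
  intro v w
  let ra := Coalgebra.Repr.arbitrary k a
  let rv := Coalgebra.Repr.arbitrary k v
  let rw' := Coalgebra.Repr.arbitrary k w
  refine Eq.trans ?_ ((ra.tmul (rv.tmul rw')).convMul_apply _ _).symm
  change τ.form ((v * w) ⊗ₜ a) = ∑ p ∈ ra.index ×ˢ (rv.index ×ˢ rw'.index),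
    τ.form ((Coalgebra.counit (R := k) (rw'.left p.2.2) • rv.left p.2.1) ⊗ₜ ra.left p.1) *
    τ.form ((Coalgebra.counit (R := k) (rv.right p.2.1) • rw'.right p.2.2) ⊗ₜ ra.right p.1)
  rw [form_mul_left, Finset.sum_product]
  refine Finset.sum_congr rfl fun l _ => ?_
  rw [Finset.sum_product]
  have h1 := sum_mul_counit (τ.form ∘ₗ (TensorProduct.mk k U A).flip (ra.left l)) v
  have h2 := sum_counit_mul (τ.form ∘ₗ (TensorProduct.mk k U A).flip (ra.right l)) w
  change τ.form (v ⊗ₜ ra.left l) * τ.form (w ⊗ₜ ra.right l) = _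
  change _ = τ.form (v ⊗ₜ ra.left l) at h1
  change _ = τ.form (w ⊗ₜ ra.right l) at h2
  rw [← h1, ← h2, Finset.sum_mul_sum]
  refine Finset.sum_congr rfl fun i _ => Finset.sum_congr rfl fun j _ => ?_
  simp only [← TensorProduct.smul_tmul', map_smul, smul_eq_mul, LinearMap.comp_apply,
    TensorProduct.mk_apply, LinearMap.flip_apply]
  ring

/-- Forms depending on different tensor factors commute for convolution. -/
theorem pull_comm {X Y : Type*} [Ring X] [Bialgebra k X] [Ring Y] [Bialgebra k Y]
    (f : WithConv (X →ₗ[k] k)) (g : WithConv (Y →ₗ[k] k)) :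
    pull k (projU k X Y) f * pull k (projA k X Y) g =
      pull k (projA k X Y) g * pull k (projU k X Y) f := by
  have hf : pull k (projU k X Y) f = toConv ((Algebra.TensorProduct.lmul' k (S := k)).toLinearMap ∘ₗ
      (toConv (TensorProduct.map f.ofConv (1 : WithConv (Y →ₗ[k] k)).ofConv)).ofConv) := by
    apply WithConv.ext
    apply TensorProduct.ext'
    intro x y
    change f.ofConv (Coalgebra.counit (R := k) y • x) = f.ofConv x * Coalgebra.counit (R := k) y
    rw [map_smul, smul_eq_mul, mul_comm]
  have hg : pull k (projA k X Y) g = toConv ((Algebra.TensorProduct.lmul' k (S := k)).toLinearMap ∘ₗ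
      (toConv (TensorProduct.map (1 : WithConv (X →ₗ[k] k)).ofConv g.ofConv)).ofConv) := by
    apply WithConv.ext
    apply TensorProduct.ext'
    intro x y
    change g.ofConv (Coalgebra.counit (R := k) x • y) = Coalgebra.counit (R := k) x * g.ofConv y
    rw [map_smul, smul_eq_mul]
  rw [hf, hg]
  have e1 := LinearMap.algHom_comp_convMul_distrib (Algebra.TensorProduct.lmul' k (S := k))
    (toConv (TensorProduct.map f.ofConv (1 : WithConv (Y →ₗ[k] k)).ofConv))
    (toConv (TensorProduct.map (1 : WithConv (X →ₗ[k] k)).ofConv g.ofConv))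
  have e2 := LinearMap.algHom_comp_convMul_distrib (Algebra.TensorProduct.lmul' k (S := k))
    (toConv (TensorProduct.map (1 : WithConv (X →ₗ[k] k)).ofConv g.ofConv))
    (toConv (TensorProduct.map f.ofConv (1 : WithConv (Y →ₗ[k] k)).ofConv))
  rw [TensorProduct.map_convMul_map, one_mul, mul_one] at e1 e2
  exact congrArg toConv (e1.symm.trans e2)

variable (k U A) in
/-- The coalgebra map `x ⊗ y ⊗ z ↦ ε(y) x ⊗ z`. -/
def p13 : ((U ⊗[k] A) ⊗[k] (U ⊗[k] A)) ⊗[k] (U ⊗[k] A) →ₗc[k] (U ⊗[k] A) ⊗[k] (U ⊗[k] A) :=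
  Coalgebra.TensorProduct.map (projU k (U ⊗[k] A) (U ⊗[k] A)) (CoalgHom.id k _)

theorem p13_tmul (u v w : U) (a b c : A) :
    p13 k U A (((u ⊗ₜ a) ⊗ₜ (v ⊗ₜ b)) ⊗ₜ (w ⊗ₜ c)) =
      (Coalgebra.counit (R := k) b * Coalgebra.counit (R := k) v) •
        ((u ⊗ₜ a) ⊗ₜ[k] (w ⊗ₜ c)) := rfl

variable (k U A) in
/-- The coalgebra map `(u ⊗ a) ⊗ (v ⊗ b) ⊗ (w ⊗ c) ↦ ε(u) ε(v) ε(c) (a ⊗ b) ⊗ w`. -/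
def qA : ((U ⊗[k] A) ⊗[k] (U ⊗[k] A)) ⊗[k] (U ⊗[k] A) →ₗc[k] (A ⊗[k] A) ⊗[k] U :=
  Coalgebra.TensorProduct.map
    (Coalgebra.TensorProduct.map (projA k U A) (projA k U A)) (projU k U A)

variable (k U A) in
/-- The coalgebra map `(u ⊗ a) ⊗ (v ⊗ b) ⊗ (w ⊗ c) ↦ ε(u) ε(b) ε(c) a ⊗ (v ⊗ w)`. -/
def qU : ((U ⊗[k] A) ⊗[k] (U ⊗[k] A)) ⊗[k] (U ⊗[k] A) →ₗc[k] A ⊗[k] (U ⊗[k] U) :=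
  (Coalgebra.TensorProduct.map (projA k U A)
    (Coalgebra.TensorProduct.map (projU k U A) (projU k U A))).comp
    (Coalgebra.TensorProduct.assoc k k (U ⊗[k] A) (U ⊗[k] A) (U ⊗[k] A)).toCoalgHom

variable (k U A) in
/-- The coalgebra map `(u ⊗ a) ⊗ (v ⊗ b) ⊗ (w ⊗ c) ↦ ε(u) ε(c) (a ⊗ v) ⊗ (b ⊗ w)`. -/
def qM : ((U ⊗[k] A) ⊗[k] (U ⊗[k] A)) ⊗[k] (U ⊗[k] A) →ₗc[k] (A ⊗[k] U) ⊗[k] (A ⊗[k] U) :=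
  ((Coalgebra.TensorProduct.assoc k k (A ⊗[k] U) A U).toCoalgHom.comp
    (Coalgebra.TensorProduct.map (Coalgebra.TensorProduct.assoc k k A U A).symm.toCoalgHom
      (CoalgHom.id k U))).comp
  (Coalgebra.TensorProduct.map
    (Coalgebra.TensorProduct.map (projA k U A) (CoalgHom.id k _)) (projU k U A))

/-- Two linear maps on `(U ⊗ A) ⊗ (U ⊗ A) ⊗ (U ⊗ A)` agree if they agree on pure tensors. -/
theorem ext_six {M : Type*} [AddCommGroup M] [Module k M]
    {f g : ((U ⊗[k] A) ⊗[k] (U ⊗[k] A)) ⊗[k] (U ⊗[k] A) →ₗ[k] M}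
    (h : ∀ (u : U) (a : A) (v : U) (b : A) (w : U) (c : A),
      f (((u ⊗ₜ a) ⊗ₜ (v ⊗ₜ b)) ⊗ₜ (w ⊗ₜ c)) = g (((u ⊗ₜ a) ⊗ₜ (v ⊗ₜ b)) ⊗ₜ (w ⊗ₜ c))) :
    f = g := by
  apply TensorProduct.ext_threefold
  intro x y z
  induction x with
  | zero => simp only [TensorProduct.zero_tmul, map_zero]
  | add x₁ x₂ h₁ h₂ => simp only [TensorProduct.add_tmul, map_add, h₁, h₂]
  | tmul u a =>
    induction y with
    | zero => simp only [TensorProduct.zero_tmul, TensorProduct.tmul_zero, map_zero]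
    | add x₁ x₂ h₁ h₂ =>
      simp only [TensorProduct.add_tmul, TensorProduct.tmul_add, map_add, h₁, h₂]
    | tmul v b =>
      induction z with
      | zero => simp only [TensorProduct.tmul_zero, map_zero]
      | add x₁ x₂ h₁ h₂ => simp only [TensorProduct.tmul_add, map_add, h₁, h₂]
      | tmul w c => exact h u a v b w c

theorem qA_tmul (u v w : U) (a b c : A) :
    qA k U A (((u ⊗ₜ a) ⊗ₜ (v ⊗ₜ b)) ⊗ₜ (w ⊗ₜ c)) =
      ((Coalgebra.counit (R := k) u • a) ⊗ₜ (Coalgebra.counit (R := k) v • b)) ⊗ₜ[k]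
        (Coalgebra.counit (R := k) c • w) := rfl

theorem qU_tmul (u v w : U) (a b c : A) :
    qU k U A (((u ⊗ₜ a) ⊗ₜ (v ⊗ₜ b)) ⊗ₜ (w ⊗ₜ c)) =
      (Coalgebra.counit (R := k) u • a) ⊗ₜ[k]
        ((Coalgebra.counit (R := k) b • v) ⊗ₜ (Coalgebra.counit (R := k) c • w)) := rfl

theorem m12_tmul (x y z : U ⊗[k] A) :
    m12 k (U ⊗[k] A) ((x ⊗ₜ y) ⊗ₜ z) = (x * y) ⊗ₜ z := rfl

theorem m23_tmul (x y z : U ⊗[k] A) :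
    m23 k (U ⊗[k] A) ((x ⊗ₜ y) ⊗ₜ z) = x ⊗ₜ (y * z) := rfl

theorem p12_tmul (u v w : U) (a b c : A) :
    p12 k (U ⊗[k] A) (((u ⊗ₜ a) ⊗ₜ (v ⊗ₜ b)) ⊗ₜ (w ⊗ₜ c)) =
      (Coalgebra.counit (R := k) c * Coalgebra.counit (R := k) w) •
        ((u ⊗ₜ a) ⊗ₜ[k] (v ⊗ₜ b)) := rfl

theorem p23_tmul (u v w : U) (a b c : A) :
    p23 k (U ⊗[k] A) (((u ⊗ₜ a) ⊗ₜ (v ⊗ₜ b)) ⊗ₜ (w ⊗ₜ c)) =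
      (Coalgebra.counit (R := k) a * Coalgebra.counit (R := k) u) •
        ((v ⊗ₜ b) ⊗ₜ[k] (w ⊗ₜ c)) := rfl

theorem pull_apply {C D E : Type*} [AddCommGroup C] [Module k C] [Coalgebra k C]
    [AddCommGroup D] [Module k D] [Coalgebra k D] [Ring E] [Algebra k E] (h : C →ₗc[k] D)
    (f : WithConv (D →ₗ[k] E)) (c : C) : (pull E h f).ofConv c = f.ofConv (h c) := rfl

theorem map_tmul' {X Y Z W : Type*} [Ring X] [Bialgebra k X] [Ring Y] [Bialgebra k Y]
    [Ring Z] [Bialgebra k Z] [Ring W] [Bialgebra k W] (f : X →ₗc[k] Y) (g : Z →ₗc[k] W)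
    (x : X) (z : Z) : Coalgebra.TensorProduct.map f g (x ⊗ₜ z) = f x ⊗ₜ[k] g z := rfl

theorem projA_tmul {X Y : Type*} [Ring X] [Bialgebra k X] [Ring Y] [Bialgebra k Y]
    (x : X) (y : Y) : projA k X Y (x ⊗ₜ y) = Coalgebra.counit (R := k) x • y := rfl

theorem projU_tmul {X Y : Type*} [Ring X] [Bialgebra k X] [Ring Y] [Bialgebra k Y]
    (x : X) (y : Y) : projU k X Y (x ⊗ₜ y) = Coalgebra.counit (R := k) y • x := rfl

theorem pull_m12 (τ : SkewPairing k U A) :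
    pull k (m12 k (U ⊗[k] A)) τ.sigma.val =
      pull k (p23 k (U ⊗[k] A)) τ.sigma.val * pull k (p13 k U A) τ.sigma.val := by
  have e := congrArg
    (pull (C := ((U ⊗[k] A) ⊗[k] (U ⊗[k] A)) ⊗[k] (U ⊗[k] A)) k (qA k U A)) τ.pull_mul_right
  rw [map_mul] at e
  refine Eq.trans ?_ (e.trans (congrArg₂ (· * ·) ?_ ?_))
  · apply WithConv.ext
    apply ext_six
    intro u a v b w c
    rw [pull_apply, pull_apply, pull_apply, m12_tmul, qA_tmul, map_tmul',
      Bialgebra.coe_mulCoalgHom, LinearMap.mul'_apply, CoalgHom.id_apply, flipForm_tmul,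
      Algebra.TensorProduct.tmul_mul_tmul, sigma_tmul, Bialgebra.counit_mul, smul_mul_smul_comm]
    simp only [map_smul, ← TensorProduct.smul_tmul', TensorProduct.tmul_smul, smul_eq_mul]
    ring
  · apply WithConv.ext
    apply ext_six
    intro u a v b w c
    rw [pull_apply, pull_apply, pull_apply, p23_tmul, qA_tmul, map_tmul', projA_tmul,
      CoalgHom.id_apply, flipForm_tmul, LinearMap.map_smul τ.sigma.val.ofConv, sigma_tmul]
    simp only [map_smul, ← TensorProduct.smul_tmul', TensorProduct.tmul_smul, smul_eq_mul]
    ring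
  · apply WithConv.ext
    apply ext_six
    intro u a v b w c
    rw [pull_apply, pull_apply, pull_apply, p13_tmul, qA_tmul, map_tmul', projU_tmul,
      CoalgHom.id_apply, flipForm_tmul, LinearMap.map_smul τ.sigma.val.ofConv, sigma_tmul]
    simp only [map_smul, ← TensorProduct.smul_tmul', TensorProduct.tmul_smul, smul_eq_mul]
    ring

theorem pull_m23 (τ : SkewPairing k U A) :
    pull k (m23 k (U ⊗[k] A)) τ.sigma.val =
      pull k (p12 k (U ⊗[k] A)) τ.sigma.val * pull k (p13 k U A) τ.sigma.val := by
  have e := congrArg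
    (pull (C := ((U ⊗[k] A) ⊗[k] (U ⊗[k] A)) ⊗[k] (U ⊗[k] A)) k (qU k U A)) τ.pull_mul_left
  rw [map_mul] at e
  refine Eq.trans ?_ (e.trans (congrArg₂ (· * ·) ?_ ?_))
  · apply WithConv.ext
    apply ext_six
    intro u a v b w c
    rw [pull_apply, pull_apply, pull_apply, m23_tmul, qU_tmul, map_tmul',
      Bialgebra.coe_mulCoalgHom, LinearMap.mul'_apply, CoalgHom.id_apply, flipForm_tmul,
      Algebra.TensorProduct.tmul_mul_tmul, sigma_tmul, Bialgebra.counit_mul, smul_mul_smul_comm]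
    simp only [map_smul, ← TensorProduct.smul_tmul', TensorProduct.tmul_smul, smul_eq_mul]
    ring
  · apply WithConv.ext
    apply ext_six
    intro u a v b w c
    rw [pull_apply, pull_apply, pull_apply, p12_tmul, qU_tmul, map_tmul', projU_tmul,
      CoalgHom.id_apply, flipForm_tmul, LinearMap.map_smul τ.sigma.val.ofConv, sigma_tmul]
    simp only [map_smul, ← TensorProduct.smul_tmul', TensorProduct.tmul_smul, smul_eq_mul]
    ring
  · apply WithConv.ext
    apply ext_six
    intro u a v b w c
    rw [pull_apply, pull_apply, pull_apply, p13_tmul, qU_tmul, map_tmul', projA_tmul,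
      CoalgHom.id_apply, flipForm_tmul, LinearMap.map_smul τ.sigma.val.ofConv, sigma_tmul]
    simp only [map_smul, ← TensorProduct.smul_tmul', TensorProduct.tmul_smul, smul_eq_mul]
    ring

theorem pull_p12_comm (τ : SkewPairing k U A) :
    pull k (p12 k (U ⊗[k] A)) τ.sigma.val * pull k (p23 k (U ⊗[k] A)) τ.sigma.val =
      pull k (p23 k (U ⊗[k] A)) τ.sigma.val * pull k (p12 k (U ⊗[k] A)) τ.sigma.val := by
  have e := congrArg
    (pull (C := ((U ⊗[k] A) ⊗[k] (U ⊗[k] A)) ⊗[k] (U ⊗[k] A)) k (qM k U A)) (pull_comm τ.flipForm τ.flipForm)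
  rw [map_mul, map_mul] at e
  have h12 : pull k (qM k U A) (pull k (projU k (A ⊗[k] U) (A ⊗[k] U)) τ.flipForm) =
      pull k (p12 k (U ⊗[k] A)) τ.sigma.val := by
    apply WithConv.ext
    apply ext_six
    intro u a v b w c
    change τ.flipForm.ofConv ((Coalgebra.counit (R := k) (Coalgebra.counit (R := k) c • w) •
        Coalgebra.counit (R := k) b) • ((Coalgebra.counit (R := k) u • a) ⊗ₜ v)) =
      τ.form (proj k U A ((Coalgebra.counit (R := k) c • Coalgebra.counit (R := k) w) •
        ((u ⊗ₜ a) ⊗ₜ (v ⊗ₜ b))))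
    rw [map_smul (proj k U A), proj_tmul, map_smul, flipForm_tmul]
    simp only [map_smul, ← TensorProduct.smul_tmul', smul_eq_mul]
    ring
  have h23 : pull k (qM k U A) (pull k (projA k (A ⊗[k] U) (A ⊗[k] U)) τ.flipForm) =
      pull k (p23 k (U ⊗[k] A)) τ.sigma.val := by
    apply WithConv.ext
    apply ext_six
    intro u a v b w c
    change τ.flipForm.ofConv ((Coalgebra.counit (R := k) v • Coalgebra.counit (R := k)
        (Coalgebra.counit (R := k) u • a)) • (b ⊗ₜ (Coalgebra.counit (R := k) c • w))) =
      τ.form (proj k U A ((Coalgebra.counit (R := k) a • Coalgebra.counit (R := k) u) •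
        ((v ⊗ₜ b) ⊗ₜ (w ⊗ₜ c))))
    rw [map_smul (proj k U A), proj_tmul, map_smul, flipForm_tmul]
    simp only [map_smul, TensorProduct.tmul_smul, smul_eq_mul]
    ring
  rw [h12, h23] at e
  exact e

/-- The form `σ` is a 2-cocycle for the tensor product bialgebra `U ⊗ A`. -/
theorem sigma_isTwoCocycle (τ : SkewPairing k U A) : IsTwoCocycle τ.sigma.val.ofConv := by
  rw [isTwoCocycle_iff, Units.ext_iff]
  change pull k (p12 k (U ⊗[k] A)) τ.sigma.val * pull k (m12 k (U ⊗[k] A)) τ.sigma.val =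
    pull k (p23 k (U ⊗[k] A)) τ.sigma.val * pull k (m23 k (U ⊗[k] A)) τ.sigma.val
  rw [pull_m12, pull_m23, ← mul_assoc, pull_p12_comm, mul_assoc]

variable (k U A) in
/-- The coalgebra map `u ↦ u ⊗ 1`. -/
def coalgInclU : U →ₗc[k] U ⊗[k] A :=
  (Coalgebra.TensorProduct.map (CoalgHom.id k U)
    ((Bialgebra.unitBialgHom k A : k →ₐc[k] A) : k →ₗc[k] A)).comp
    (Coalgebra.TensorProduct.rid k k U).symm.toCoalgHom

variable (k U A) in
/-- The coalgebra map `a ↦ 1 ⊗ a`. -/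
def coalgInclA : A →ₗc[k] U ⊗[k] A :=
  (Coalgebra.TensorProduct.map ((Bialgebra.unitBialgHom k U : k →ₐc[k] U) : k →ₗc[k] U)
    (CoalgHom.id k A)).comp (Coalgebra.TensorProduct.lid k A).symm.toCoalgHom

theorem twistMul_eq_of_pull_eq_one (τ : SkewPairing k U A) {C : Type*} [AddCommGroup C]
    [Module k C] [Coalgebra k C] (h : C →ₗc[k] (U ⊗[k] A) ⊗[k] (U ⊗[k] A))
    (hh : pull k h τ.sigma.val = 1) (c : C) :
    twistMul τ.sigma (h c) = LinearMap.mul' k (U ⊗[k] A) (h c) := by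
  have h1 : Units.map (pull k h) τ.sigma = 1 := Units.ext hh
  have e := twistMul_comp τ.sigma h
  rw [h1, inv_one, Units.val_one, scal_one, one_mul, mul_one] at e
  exact DFunLike.congr_fun (congrArg WithConv.ofConv e) c

/-- `(u ⊗ 1)(u' ⊗ a') = uu' ⊗ a'` for the twisted multiplication. -/
theorem twistMul_one_right (τ : SkewPairing k U A) (u u' : U) (a' : A) :
    twistMul τ.sigma ((u ⊗ₜ 1) ⊗ₜ (u' ⊗ₜ a')) = (u * u') ⊗ₜ[k] a' := by
  have e := τ.twistMul_eq_of_pull_eq_one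
    (Coalgebra.TensorProduct.map (coalgInclU k U A) (CoalgHom.id k (U ⊗[k] A))) ?_
    (u ⊗ₜ (u' ⊗ₜ a'))
  · have h1 : Coalgebra.TensorProduct.map (coalgInclU k U A) (CoalgHom.id k (U ⊗[k] A))
        (u ⊗ₜ (u' ⊗ₜ a')) = (u ⊗ₜ[k] (1 : A)) ⊗ₜ[k] (u' ⊗ₜ[k] a') := by
      simp [coalgInclU]
    rw [h1] at e
    simpa using e
  · apply WithConv.ext
    apply TensorProduct.ext
    ext v : 1
    apply TensorProduct.ext'
    intro w c
    change τ.sigma.val.ofConv ((v ⊗ₜ algebraMap k A 1) ⊗ₜ (w ⊗ₜ c)) =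
      Coalgebra.counit (R := k) (w ⊗ₜ[k] c) • Coalgebra.counit (R := k) v
    rw [map_one, sigma_tmul, form_one_right, TensorProduct.counit_tmul]
    simp only [smul_eq_mul]
    ring

/-- `(u ⊗ a)(1 ⊗ a') = u ⊗ aa'` for the twisted multiplication. -/
theorem twistMul_one_left (τ : SkewPairing k U A) (u : U) (a a' : A) :
    twistMul τ.sigma ((u ⊗ₜ a) ⊗ₜ (1 ⊗ₜ a')) = u ⊗ₜ[k] (a * a') := by
  have e := τ.twistMul_eq_of_pull_eq_one
    (Coalgebra.TensorProduct.map (CoalgHom.id k (U ⊗[k] A)) (coalgInclA k U A)) ?_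
    ((u ⊗ₜ a) ⊗ₜ a')
  · have h1 : Coalgebra.TensorProduct.map (CoalgHom.id k (U ⊗[k] A)) (coalgInclA k U A)
        ((u ⊗ₜ a) ⊗ₜ a') = (u ⊗ₜ[k] a) ⊗ₜ[k] ((1 : U) ⊗ₜ[k] a') := by
      simp [coalgInclA]
    rw [h1] at e
    simpa using e
  · apply WithConv.ext
    apply TensorProduct.ext_threefold
    intro v b c
    change τ.sigma.val.ofConv ((v ⊗ₜ b) ⊗ₜ (algebraMap k U 1 ⊗ₜ c)) =
      Coalgebra.counit (R := k) c • Coalgebra.counit (R := k) (v ⊗ₜ[k] b)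
    rw [map_one, sigma_tmul, form_one_left, TensorProduct.counit_tmul]
    simp only [smul_eq_mul]
    ring

/-- The algebra `H = (U ⊗ A)^σ`: the vector space `U ⊗ A` with the multiplication of the tensor
product bialgebra twisted by the 2-cocycle `σ`. -/
def H (_τ : SkewPairing k U A) : Type _ := U ⊗[k] A

variable (τ : SkewPairing k U A)

instance instAddCommGroup : AddCommGroup τ.H :=
  (TensorProduct.addCommGroup : AddCommGroup (U ⊗[k] A))

instance instModule : Module k τ.H := (TensorProduct.instModule : Module k (U ⊗[k] A))

/-- The element `u ⊗ a` of `H`. -/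
def tmul (u : U) (a : A) : τ.H := (u ⊗ₜ[k] a : U ⊗[k] A)

theorem tmul_induction {p : τ.H → Prop} (x : τ.H) (h0 : p 0) (ht : ∀ u a, p (τ.tmul u a))
    (ha : ∀ x y, p x → p y → p (x + y)) : p x :=
  TensorProduct.induction_on (motive := p) x h0 ht ha

/-- The multiplication of `H` as a bilinear map. -/
def mulH : τ.H →ₗ[k] τ.H →ₗ[k] τ.H :=
  TensorProduct.curry (R := k) (twistMul τ.sigma : (U ⊗[k] A) ⊗[k] (U ⊗[k] A) →ₗ[k] U ⊗[k] A)

theorem mulH_one_right (u u' : U) (a' : A) :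
    τ.mulH (τ.tmul u 1) (τ.tmul u' a') = τ.tmul (u * u') a' :=
  τ.twistMul_one_right u u' a'

theorem mulH_one_left (u : U) (a a' : A) :
    τ.mulH (τ.tmul u a) (τ.tmul 1 a') = τ.tmul u (a * a') :=
  τ.twistMul_one_left u a a'

instance instRing : Ring τ.H where
  __ := τ.instAddCommGroup
  mul x y := τ.mulH x y
  one := τ.tmul 1 1
  mul_assoc x y z := twistMul_assoc τ.sigma τ.sigma_isTwoCocycle x y z
  one_mul x := by
    change τ.mulH (τ.tmul 1 1) x = x
    refine τ.tmul_induction (p := fun x => τ.mulH (τ.tmul 1 1) x = x) x (map_zero _)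
      (fun u a => ?_) (fun x y hx hy => ?_)
    · rw [mulH_one_right, one_mul]
    · rw [map_add, hx, hy]
  mul_one x := by
    change τ.mulH x (τ.tmul 1 1) = x
    refine τ.tmul_induction (p := fun x => τ.mulH x (τ.tmul 1 1) = x) x ?_
      (fun u a => ?_) (fun x y hx hy => ?_)
    · rw [map_zero, LinearMap.zero_apply]
    · rw [mulH_one_left, mul_one]
    · rw [map_add, LinearMap.add_apply, hx, hy]
  left_distrib x y z := map_add (τ.mulH x) y z
  right_distrib x y z := LinearMap.map_add₂ τ.mulH x y z
  zero_mul x := LinearMap.map_zero₂ τ.mulH x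
  mul_zero x := map_zero (τ.mulH x)

theorem mul_def (x y : τ.H) : x * y = τ.mulH x y := rfl

instance instAlgebra : Algebra k τ.H :=
  Algebra.ofModule (fun r x y => LinearMap.map_smul₂ τ.mulH r x y)
    (fun r x y => map_smul (τ.mulH x) r y)

/-- The algebra map `U → H`, `u ↦ u ⊗ 1`. -/
def inclU : U →ₐ[k] τ.H :=
  AlgHom.ofLinearMap ((TensorProduct.mk k U A).flip 1) rfl
    (fun u u' => (τ.mulH_one_right u u' 1).symm)

/-- The algebra map `A → H`, `a ↦ 1 ⊗ a`. -/
def inclA : A →ₐ[k] τ.H :=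
  AlgHom.ofLinearMap (TensorProduct.mk k U A 1) rfl
    (fun a a' => (τ.mulH_one_left 1 a a').symm)

/-! ### The modules `L(ρ, χ)` -/

/-- The linear map `id ⊗ χ : H → U`, `u ⊗ a ↦ χ(a) u`. -/
def idTensor (χ : A →ₐ[k] k) : τ.H →ₗ[k] U :=
  ((TensorProduct.rid k U).toLinearMap ∘ₗ TensorProduct.map LinearMap.id χ.toLinearMap :
    U ⊗[k] A →ₗ[k] U)

theorem idTensor_tmul (χ : A →ₐ[k] k) (u : U) (a : A) :
    τ.idTensor χ (τ.tmul u a) = χ a • u := rfl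

theorem idTensor_mul_inclA (χ : A →ₐ[k] k) (h : τ.H) (a : A) :
    τ.idTensor χ (h * τ.inclA a) = χ a • τ.idTensor χ h := by
  refine τ.tmul_induction (p := fun h => τ.idTensor χ (h * τ.inclA a) = χ a • τ.idTensor χ h) h
    ?_ (fun u b => ?_) (fun x y hx hy => ?_)
  · rw [zero_mul, map_zero, smul_zero]
  · change τ.idTensor χ (τ.mulH (τ.tmul u b) (τ.tmul 1 a)) = _
    rw [mulH_one_left, idTensor_tmul, idTensor_tmul, map_mul, smul_smul, mul_comm]
  · rw [add_mul, map_add, map_add, hx, hy, smul_add]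

theorem idTensor_mul (χ : A →ₐ[k] k) (h x : τ.H) :
    τ.idTensor χ (h * x) = τ.idTensor χ (h * τ.inclU (τ.idTensor χ x)) := by
  refine τ.tmul_induction
    (p := fun x => τ.idTensor χ (h * x) = τ.idTensor χ (h * τ.inclU (τ.idTensor χ x))) x
    ?_ (fun u a => ?_) (fun x y hx hy => ?_)
  · rw [map_zero, map_zero]
  · have e : τ.tmul u a = τ.inclU u * τ.inclA a := by
      change _ = τ.mulH (τ.tmul u 1) (τ.tmul 1 a)
      rw [mulH_one_left, one_mul]
    rw [idTensor_tmul, e, ← mul_assoc, idTensor_mul_inclA, map_smul τ.inclU, mul_smul_comm,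
      map_smul]
  · rw [mul_add, map_add, hx, hy, map_add (τ.idTensor χ) x y, map_add τ.inclU, mul_add, map_add]

/-- The left `H`-module `U_χ`, i.e. `H ⊗_A k_χ` identified with the vector space `U` via
`(u ⊗ a) ⊗_A 1 ↦ χ(a) u`; the action is `h · u' = (id ⊗ χ)(h (u' ⊗ 1))`. -/
def Ind (_τ : SkewPairing k U A) (_χ : A →ₐ[k] k) : Type _ := U

instance instAddCommGroupInd (χ : A →ₐ[k] k) : AddCommGroup (τ.Ind χ) :=
  (Ring.toAddCommGroup : AddCommGroup U)

/-- The identification of the vector spaces `U` and `U_χ`. -/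
def toInd (χ : A →ₐ[k] k) : U ≃+ τ.Ind χ := AddEquiv.refl U

instance instModuleInd (χ : A →ₐ[k] k) : Module τ.H (τ.Ind χ) where
  smul h u := τ.toInd χ (τ.idTensor χ (h * τ.inclU ((τ.toInd χ).symm u)))
  one_smul u := by
    change τ.idTensor χ (1 * τ.inclU u) = u
    rw [one_mul]
    change χ 1 • (τ.toInd χ).symm u = (τ.toInd χ).symm u
    rw [map_one, one_smul]
  mul_smul h h' u := by
    change τ.idTensor χ (h * h' * τ.inclU u) =
      τ.idTensor χ (h * τ.inclU (τ.idTensor χ (h' * τ.inclU u)))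
    rw [mul_assoc, idTensor_mul]
  smul_zero h := by
    change τ.idTensor χ (h * τ.inclU 0) = 0
    rw [map_zero, mul_zero, map_zero]
  smul_add h u v := by
    change τ.idTensor χ (h * τ.inclU ((τ.toInd χ).symm (u + v))) =
      τ.idTensor χ (h * τ.inclU ((τ.toInd χ).symm u)) +
        τ.idTensor χ (h * τ.inclU ((τ.toInd χ).symm v))
    rw [map_add, map_add, mul_add, map_add]
  add_smul h h' u := by
    change τ.idTensor χ ((h + h') * τ.inclU u) =
      τ.idTensor χ (h * τ.inclU u) + τ.idTensor χ (h' * τ.inclU u)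
    rw [add_mul, map_add]
  zero_smul u := by
    change τ.idTensor χ (0 * τ.inclU u) = 0
    rw [zero_mul, map_zero]

/-- `(u ⊗ a) · u' = u (id ⊗ χ)((1 ⊗ a)(u' ⊗ 1))`. -/
theorem tmul_smul_toInd (χ : A →ₐ[k] k) (u u' : U) (a : A) :
    τ.tmul u a • τ.toInd χ u' = τ.toInd χ (u * τ.idTensor χ (τ.tmul 1 a * τ.tmul u' 1)) := by
  change τ.idTensor χ (τ.tmul u a * τ.tmul u' 1) = u * τ.idTensor χ (τ.tmul 1 a * τ.tmul u' 1)
  have e : τ.tmul u a = τ.tmul u 1 * τ.tmul 1 a := by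
    rw [mul_def, mulH_one_left, one_mul]
  rw [e, mul_assoc]
  generalize τ.tmul 1 a * τ.tmul u' 1 = x
  refine τ.tmul_induction
    (p := fun x => τ.idTensor χ (τ.tmul u 1 * x) = u * τ.idTensor χ x) x
    ?_ (fun v b => ?_) (fun x y hx hy => ?_)
  · rw [mul_zero, map_zero, mul_zero]
  · rw [mul_def, mulH_one_right, idTensor_tmul, idTensor_tmul, mul_smul_comm]
  · rw [mul_add, map_add, map_add, hx, hy, mul_add]

/-- `I(ρ, χ)`: the sum of all `H`-submodules of `U_χ` contained in `Ker ρ`. -/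
def maxSub (ρ : U →ₐ[k] k) (χ : A →ₐ[k] k) : Submodule τ.H (τ.Ind χ) :=
  sSup {W | ∀ x ∈ W, ρ ((τ.toInd χ).symm x) = 0}

/-- `L(ρ, χ) = U_χ / I(ρ, χ)`. -/
abbrev L (ρ : U →ₐ[k] k) (χ : A →ₐ[k] k) : Type _ := τ.Ind χ ⧸ τ.maxSub ρ χ

/-! ### The category `ₕM` -/

section Objects

variable {M : Type*} [AddCommGroup M] [Module k M] [Module τ.H M] [IsScalarTower k τ.H M]

/-- A subspace of an `H`-module is an `A`-submodule. -/
def IsASubmodule (V : Submodule k M) : Prop := ∀ (a : A), ∀ m ∈ V, τ.inclA a • m ∈ V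

/-- A subspace of an `H`-module is a `U`-submodule. -/
def IsUSubmodule (V : Submodule k M) : Prop := ∀ (u : U), ∀ m ∈ V, τ.inclU u • m ∈ V

variable (M) in
/-- The `H`-module `M` is an object of `ₕM`: it is generated by a one-dimensional
`A`-submodule and has a codimension one `U`-submodule containing no nonzero `H`-submodule. -/
structure IsObject : Prop where
  exists_line : ∃ V : Submodule k M, τ.IsASubmodule V ∧ Module.finrank k V = 1 ∧
    Submodule.span τ.H (V : Set M) = ⊤
  exists_hyperplane : ∃ N : Submodule k M, τ.IsUSubmodule N ∧ Module.finrank k (M ⧸ N) = 1 ∧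
    ∀ W : Submodule τ.H M, (W : Set M) ⊆ N → W = ⊥

end Objects

open scoped ModuleCat in
/-- The objects of `ₕM` among all left `H`-modules. -/
def objectProperty : CategoryTheory.ObjectProperty (ModuleCat.{w} τ.H) :=
  fun M => τ.IsObject M

/-- The category `ₕM`, a full subcategory of the category of left `H`-modules. -/
abbrev Cat := (objectProperty.{w} τ).FullSubcategory

/-- The set `[ₕM]` of isomorphism classes of objects of `ₕM`. -/
abbrev IsoClasses := Quotient (CategoryTheory.isIsomorphicSetoid (Cat.{w} τ))

end SkewPairing

/-- All finite-dimensional irreducible left modules over the `k`-algebra `R` are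
one-dimensional. (Irreducible modules are cyclic, so those in the universe of `R` suffice.) -/
def FiniteDimensionalIrreduciblesAreLines (k : Type*) [Field k] (R : Type w) [Ring R]
    [Algebra k R] : Prop :=
  ∀ (V : Type w) [AddCommGroup V] [Module k V] [Module R V] [IsScalarTower k R V]
    [FiniteDimensional k V] [IsSimpleModule R V], Module.finrank k V = 1

end

/-! The engine is a rigidity statement: a character of a Hopf algebra of the given type is
determined by its values on group-like elements (`algHom_ext_of_isGroupLikeElem`). It suffices that
a character `ψ` trivial on group-likes kills every skew primitive of finite type
(`IsSkewPrimitive.apply_eq_zero`). After normalisation `Δ(a) = a ⊗ g + 1 ⊗ a`, the translation `x ↦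
x₍₁₎ ψ(x₍₂₎)` is an algebra map that fixes the coradical and sends `a` to `a + ψ(a)`. By
Cayley–Hamilton, `a` satisfies a monic polynomial over the commutative coradical. If `ψ(a) ≠ 0`,
subtracting the relation from its translate lowers the degree by one and multiplies the leading
coefficient by a nonzero integer times `ψ(a)`. Iterating makes the leading coefficient vanish, a
contradiction. On group-likes convolution is multiplication in `k`, so convolution of characters is
commutative.

For group-like `g ∈ A`, the form `t = τ(-, g)` is a character of `U`, and applying `ρ ⊗ χ` to `(1 ⊗
g)(u ⊗ 1)` gives `χ(g) (t * ρ * t⁻¹)(u)`, which commutativity reduces to `χ(g) ρ(u)`. The roles of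
`U` and `A` can be exchanged.

An object of `ₕM` amounts to a generating vector `m` of `A`-weight `χ` and a functional `f` of
`U`-weight `ρ` with `f m = 1` and no nonzero `H`-submodule in its kernel (`HasWeights`). An
`A`-weight vector `x` satisfies `H x = U x`, so it vanishes as soon as `f x = 0`. By the preceding
formula group-likes of `A` act on `f` through `χ`, so rigidity forces every weight vector to have
weight `χ` and to be a multiple of `m`. The dual argument fixes `f` and `ρ`. This gives b) and
injectivity in a); surjectivity holds because the kernel of `U_χ → M`, `u ↦ u m`, is `I(ρ, χ)`. For
c), a nonzero submodule of a finite-dimensional object contains an `A`-line, which by uniqueness is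
the generating one. -/

noncomputable section

namespace HopfSub

open WithConv Polynomial

/-! ### Group-like elements and the coradical of a pointed coalgebra -/

section GroupLike

variable {k C : Type*} [Field k] [AddCommGroup C] [Module k C] [Coalgebra k C]

theorem isSubcoalgebra_span_of_isGroupLikeElem {g : C} (hg : IsGroupLikeElem k g) :
    IsSubcoalgebra k (k ∙ g) := by
  intro c hc
  obtain ⟨r, rfl⟩ := Submodule.mem_span_singleton.1 hc
  rw [map_smul, hg.comul_eq_tmul_self]
  refine Submodule.smul_mem _ _ ⟨⟨g, Submodule.mem_span_singleton_self g⟩ ⊗ₜ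
    ⟨g, Submodule.mem_span_singleton_self g⟩, ?_⟩
  simp [TensorProduct.mapIncl]

theorem mem_coradical_of_isGroupLikeElem {g : C} (hg : IsGroupLikeElem k g) :
    g ∈ coradical k C := by
  have hatom : IsAtom (k ∙ g) := nonzero_span_atom g hg.ne_zero
  have hs : IsSimpleSubcoalgebra k (k ∙ g) :=
    ⟨isSubcoalgebra_span_of_isGroupLikeElem hg, hatom.1, fun D _ hD => hatom.le_iff.1 hD⟩
  exact (le_sSup hs : (k ∙ g) ≤ coradical k C) (Submodule.mem_span_singleton_self g)

/-- A one-dimensional subcoalgebra is spanned by a group-like element. -/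
theorem IsSubcoalgebra.le_span_isGroupLikeElem {D : Submodule k C} (hD : IsSubcoalgebra k D)
    (h1 : Module.finrank k D = 1) : D ≤ Submodule.span k {g | IsGroupLikeElem k g} := by
  obtain ⟨c, hc0, hc⟩ := finrank_eq_one_iff'.1 h1
  have key : ∀ t : D ⊗[k] D, ∃ r : k, t = r • (c ⊗ₜ[k] c) := by
    intro t
    induction t with
    | zero => exact ⟨0, by simp⟩
    | tmul x y =>
      obtain ⟨r, rfl⟩ := hc x
      obtain ⟨s, rfl⟩ := hc y
      exact ⟨r * s, by rw [TensorProduct.smul_tmul_smul]⟩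
    | add x y hx hy =>
      obtain ⟨r, rfl⟩ := hx
      obtain ⟨s, rfl⟩ := hy
      exact ⟨r + s, by rw [add_smul]⟩
  obtain ⟨t, ht⟩ := hD c c.2
  obtain ⟨r, rfl⟩ := key t
  have hcom : Coalgebra.comul (R := k) (c : C) = r • ((c : C) ⊗ₜ[k] (c : C)) := by
    rw [← ht]; simp [TensorProduct.mapIncl]
  have hcou : (r * Coalgebra.counit (R := k) (c : C)) • (c : C) = c := by
    have := Coalgebra.rTensor_counit_comul (R := k) (c : C)
    rw [hcom] at this
    have := congrArg (TensorProduct.lid k C) this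
    simpa [smul_smul] using this
  have hc0' : (c : C) ≠ 0 := fun h => hc0 (Subtype.ext h)
  have hr : r * Coalgebra.counit (R := k) (c : C) = 1 := by
    have : (r * Coalgebra.counit (R := k) (c : C) - 1) • (c : C) = 0 := by
      rw [sub_smul, hcou, one_smul, sub_self]
    exact sub_eq_zero.1 ((smul_eq_zero.1 this).resolve_right hc0')
  have hr0 : r ≠ 0 := left_ne_zero_of_mul_eq_one hr
  have hg : IsGroupLikeElem k (r • (c : C)) :=
    ⟨by rw [map_smul, smul_eq_mul, hr], by
      rw [map_smul, hcom, TensorProduct.smul_tmul_smul, smul_smul]⟩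
  intro x hx
  obtain ⟨s, hs⟩ := hc ⟨x, hx⟩
  have hx' : x = (s * r⁻¹) • r • (c : C) := by
    rw [smul_smul, inv_mul_cancel_right₀ hr0]
    exact (congrArg Subtype.val hs).symm
  rw [hx']
  exact Submodule.smul_mem _ _ (Submodule.subset_span hg)

theorem IsPointed.coradical_le (h : IsPointed k C) :
    coradical k C ≤ Submodule.span k {g | IsGroupLikeElem k g} :=
  sSup_le fun D hD => hD.isSubcoalgebra.le_span_isGroupLikeElem (h D hD)

end GroupLike

/-! ### Lowering the degree of a polynomial relation by a shift -/

section Shift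

/-- Subtracting a polynomial from its shift by a constant lowers the degree. -/
theorem natDegree_taylor_sub_le {R : Type*} [CommRing R] {p : R[X]} {n : ℕ}
    (hp : p.natDegree ≤ n + 1) (s : R) : (taylor s p - p).natDegree ≤ n := by
  rw [natDegree_le_iff_coeff_eq_zero]
  intro j hj
  -- The `j`-th coefficient of the shifted polynomial is the `j`-th Hasse derivative evaluated at
  -- `s`. For `j > n` this derivative is the constant `p.coeff j`, which cancels.
  have h0 : (hasseDeriv j p).natDegree ≤ 0 := (natDegree_hasseDeriv_le p j).trans (by omega)
  rw [coeff_sub, taylor_coeff, eq_C_of_natDegree_le_zero h0, eval_C, hasseDeriv_coeff]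
  simp

/-- The `n`-th Hasse derivative of `p` is affine: its constant term cancels against `p.coeff n`, and
its slope is `(n + 1) * p.coeff (n + 1)`. -/
theorem coeff_taylor_sub {R : Type*} [CommRing R] {p : R[X]} {n : ℕ}
    (hp : p.natDegree ≤ n + 1) (s : R) :
    (taylor s p - p).coeff n = ((n + 1 : ℕ) : R) * p.coeff (n + 1) * s := by
  have h0 : (hasseDeriv n p).natDegree < 2 :=
    lt_of_le_of_lt (natDegree_hasseDeriv_le p n) (by omega)
  rw [coeff_sub, taylor_coeff, eval_eq_sum_range' h0, Finset.sum_range_succ,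
    Finset.sum_range_one, hasseDeriv_coeff, hasseDeriv_coeff]
  simp [add_comm 1 n, Nat.choose_succ_self_right]

variable {k R M : Type*} [Field k] [CharZero k] [CommRing R] [Algebra k R]

variable [AddCommGroup M] [Module R M]

theorem comp_aeval_of_comm {N : Type*} [AddCommGroup N] [Module R N] {β : M →ₗ[R] N}
    {f : Module.End R M} {g : Module.End R N} (h : ∀ x, β (f x) = g (β x)) (p : R[X]) (x : M) :
    β (aeval f p x) = aeval g p (β x) := by
  induction p using Polynomial.induction_on' with
  | add p q hp hq => simp only [map_add, LinearMap.add_apply, hp, hq]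
  | monomial n r =>
    have hn : ∀ x, β ((f ^ n) x) = (g ^ n) (β x) := by
      induction n with
      | zero => exact fun x => rfl
      | succ n ih => intro x; rw [pow_succ, pow_succ, Module.End.mul_apply, ih, h]; rfl
    rw [aeval_monomial, aeval_monomial, Module.End.mul_apply, Module.End.mul_apply,
      Module.algebraMap_end_apply, Module.algebraMap_end_apply, map_smul, hn]

/-- If `β f = (f + s) β` for a nonzero scalar `s`, and `β` fixes a vector `x` with trivial
annihilator, then the vectors `fⁿ x` are linearly independent over `R`. -/
theorem coeff_eq_zero_of_aeval_apply_eq_zero {β f : Module.End R M} {s : k} (hs : s ≠ 0)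
    (h : ∀ x, β (f x) = (f + algebraMap R (Module.End R M) (algebraMap k R s)) (β x)) {x : M} (hx : β x = x)
    (hann : ∀ r : R, r • x = 0 → r = 0) (n : ℕ) :
    ∀ p : R[X], p.natDegree ≤ n → aeval f p x = 0 → p.coeff n = 0 := by
  induction n with
  | zero =>
    intro p hp hpx
    rw [eq_C_of_natDegree_le_zero hp, aeval_C, Module.algebraMap_end_apply] at hpx
    exact hann _ hpx
  | succ n ih =>
    intro p hp hpx
    -- Applying `β` to the relation `p(f) x = 0` turns `f` into `f + s` and keeps `x`, so the
    -- shifted polynomial is a relation too.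
    have h1 : aeval f (taylor (algebraMap k R s) p) x = 0 := by
      have e : aeval f (taylor (algebraMap k R s) p) =
          aeval (f + algebraMap R _ (algebraMap k R s)) p := by
        rw [taylor_apply, aeval_comp]; simp
      have := comp_aeval_of_comm h p x
      rw [hx, hpx, map_zero] at this
      rw [e, ← this]
    have h2 := ih (taylor (algebraMap k R s) p - p) (natDegree_taylor_sub_le hp _)
      (by rw [map_sub, LinearMap.sub_apply, h1, hpx, sub_zero])
    rw [coeff_taylor_sub hp] at h2
    -- Characteristic zero enters here: `(n + 1) s` is a nonzero scalar, hence invertible in `R`,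
    -- which itself need not be a domain.
    have hu : IsUnit (algebraMap k R (((n + 1 : ℕ) : k) * s)) :=
      (IsUnit.mk0 _ (mul_ne_zero (Nat.cast_ne_zero.2 n.succ_ne_zero) hs)).map _
    rw [← hu.mul_right_eq_zero, map_mul, map_natCast]
    linear_combination h2

end Shift

/-! ### Characters of a pointed Hopf algebra and their convolution group -/

section Characters

variable {k B : Type*} [Field k] [Ring B] [HopfAlgebra k B]

/-- The algebra endomorphism `x ↦ x₍₁₎ ψ(x₍₂₎)` given by an algebra map `ψ` to the base field. -/
def translate (ψ : B →ₐ[k] k) : B →ₐ[k] B :=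
  (Algebra.TensorProduct.rid k k B).toAlgHom.comp
    ((Algebra.TensorProduct.map (AlgHom.id k B) ψ).comp (Bialgebra.comulAlgHom k B))

theorem translate_of_isGroupLikeElem (ψ : B →ₐ[k] k) {g : B} (hg : IsGroupLikeElem k g) :
    translate ψ g = ψ g • g := by
  simp [translate, hg.comul_eq_tmul_self]

theorem translate_of_comul_eq (ψ : B →ₐ[k] k) {a g : B}
    (ha : Coalgebra.comul (R := k) a = a ⊗ₜ[k] g + 1 ⊗ₜ[k] a) :
    translate ψ a = ψ g • a + algebraMap k B (ψ a) := by
  simp [translate, ha, Algebra.algebraMap_eq_smul_one]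

/-- Pointedness makes the coradical a span of group-likes, and `translate ψ` scales each group-like
`g` by `ψ g = 1`. This makes the translation linear over the coradical. -/
theorem translate_eq_self (hB : IsPointed k B) {ψ : B →ₐ[k] k}
    (hψ : ∀ g, IsGroupLikeElem k g → ψ g = 1) (r : coradicalSubalgebra k B) :
    translate ψ (r : B) = r := by
  have h : coradicalSubalgebra k B ≤ AlgHom.equalizer (translate ψ) (AlgHom.id k B) := by
    refine Algebra.adjoin_le fun x hx => ?_
    have hle : Submodule.span k {g | IsGroupLikeElem k g} ≤
        (AlgHom.equalizer (translate ψ) (AlgHom.id k B)).toSubmodule := by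
      refine Submodule.span_le.2 fun g hg => ?_
      change translate ψ g = g
      rw [translate_of_isGroupLikeElem ψ hg, hψ g hg, one_smul]
    exact hle (hB.coradical_le hx)
  exact h r.2

theorem conv_apply_of_isGroupLikeElem (χ χ' : WithConv (B →ₐ[k] k)) {g : B}
    (hg : IsGroupLikeElem k g) : (χ * χ').ofConv g = χ.ofConv g * χ'.ofConv g := by
  have := AlgHom.convMul_apply χ χ' g
  rw [hg.comul_eq_tmul_self, Algebra.TensorProduct.lift_tmul] at this
  exact this

/-- The convolution inverse of an algebra map to the base field. -/
def convInv (χ : B →ₐ[k] k) : B →ₐ[k] k :=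
  AlgHom.ofLinearMap (χ.toLinearMap ∘ₗ HopfAlgebra.antipode k) (by simp)
    -- The antipode reverses products, but the target `k` is commutative.
    (fun x y => by simp [HopfAlgebra.antipode_mul_antidistrib, mul_comm])

theorem convInv_apply (χ : B →ₐ[k] k) (b : B) : convInv χ b = χ (HopfAlgebra.antipode k b) := rfl

theorem convInv_mul (χ : B →ₐ[k] k) : toConv (convInv χ) * toConv χ = 1 := by
  apply WithConv.ext
  ext b
  change (toConv (convInv χ).toLinearMap * toConv χ.toLinearMap) b = _
  rw [(Coalgebra.Repr.arbitrary k b).convMul_apply]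
  simpa [convInv_apply] using congrArg χ
    (HopfAlgebra.sum_antipode_mul_eq_algebraMap_counit (Coalgebra.Repr.arbitrary k b))

theorem mul_convInv (χ : B →ₐ[k] k) : toConv χ * toConv (convInv χ) = 1 := by
  apply WithConv.ext
  ext b
  change (toConv χ.toLinearMap * toConv (convInv χ).toLinearMap) b = _
  rw [(Coalgebra.Repr.arbitrary k b).convMul_apply]
  simpa [convInv_apply] using congrArg χ
    (HopfAlgebra.sum_mul_antipode_eq_algebraMap_counit (Coalgebra.Repr.arbitrary k b))

theorem isUnit_conv (χ : WithConv (B →ₐ[k] k)) : IsUnit χ :=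
  ⟨⟨χ, toConv (convInv χ.ofConv), mul_convInv _, convInv_mul _⟩, rfl⟩

variable [CharZero k]

open scoped IsMulCommutative in
/-- An algebra map which is trivial on group-like elements vanishes on skew primitive elements of
finite type. -/
theorem IsSkewPrimitive.apply_eq_zero (hB : IsPointed k B) (hB₀ : HasCommutativeCoradical k B)
    {ψ : B →ₐ[k] k} (hψ : ∀ g, IsGroupLikeElem k g → ψ g = 1) {b : B}
    (hb : IsSkewPrimitive k b) (hfin : IsOfFiniteType k b) : ψ b = 0 := by
  obtain ⟨g, h, hg, hh, hcom⟩ := hb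
  have : IsMulCommutative (coradicalSubalgebra k B) := Algebra.isMulCommutative_adjoin k hB₀
  have hh' := hh.antipode
  -- Multiplying by `h⁻¹ = S(h)` makes the left group-like trivial without changing the value of
  -- `ψ`.
  set a := HopfAlgebra.antipode k h * b with ha
  have hcoma : Coalgebra.comul (R := k) a =
      a ⊗ₜ[k] (HopfAlgebra.antipode k h * g) + 1 ⊗ₜ[k] a := by
    rw [ha, Bialgebra.comul_mul, hcom, hh'.comul_eq_tmul_self, mul_add,
      Algebra.TensorProduct.tmul_mul_tmul, Algebra.TensorProduct.tmul_mul_tmul,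
      hh.antipode_mul_cancel]
  have hψa : ψ a = ψ b := by rw [ha, map_mul, hψ _ hh', one_mul]
  by_contra hne
  have := hfin.2
  have hRE : ∀ x ∈ coradical k B, x ∈ hopfClosure k ((coradical k B : Set B) ∪ {b}) :=
    fun x hx => Algebra.mem_sInf.2 fun E hE => hE.2 (Or.inl hx)
  have hbE : b ∈ hopfClosure k ((coradical k B : Set B) ∪ {b}) :=
    Algebra.mem_sInf.2 fun E hE => hE.2 (Or.inr rfl)
  have haE : a ∈ hopfClosure k ((coradical k B : Set B) ∪ {b}) :=
    mul_mem (hRE _ (mem_coradical_of_isGroupLikeElem hh')) hbE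
  -- Right multiplication by `a` is linear for the left action of the coradical even if `a` does not
  -- commute with it; `aeval f p 1` is then the polynomial in `a` with its coefficients on the left.
  let f : Module.End (coradicalSubalgebra k B) B :=
    { toFun := fun x => x * a
      map_add' := fun x y => add_mul x y a
      map_smul' := fun r x => mul_assoc (r : B) x a }
  let β : Module.End (coradicalSubalgebra k B) B :=
    { toFun := translate ψ
      map_add' := map_add _
      map_smul' := fun r x => by
        change translate ψ ((r : B) * x) = (r : B) * translate ψ x
        rw [map_mul, translate_eq_self hB hψ] }
  have hfE : ∀ x ∈ hopfExtension k b, f x ∈ hopfExtension k b := fun x hx =>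
    mul_mem (S := Subalgebra k B) hx haE
  -- Cayley–Hamilton for an endomorphism of a finite module over a commutative ring; this is the use
  -- of finite type.
  obtain ⟨p, hmonic, hp⟩ := LinearMap.exists_monic_and_aeval_eq_zero _ (f.restrict hfE)
  have hp1 : aeval f p (1 : B) = 0 := by
    have h1 : (1 : B) ∈ hopfExtension k b := one_mem (hopfClosure k _)
    have e := comp_aeval_of_comm (β := (hopfExtension k b).subtype) (f := f.restrict hfE) (g := f)
      (fun _ => rfl) p ⟨1, h1⟩
    rw [hp] at e
    exact e.symm
  have hβ : ∀ x, β (f x) = (f + algebraMap (coradicalSubalgebra k B) (Module.End (coradicalSubalgebra k B) B)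
      (algebraMap k (coradicalSubalgebra k B) (ψ b))) (β x) := by
    intro x
    change translate ψ (x * a) = translate ψ x * a + _ * translate ψ x
    rw [map_mul, translate_of_comul_eq ψ hcoma, map_mul, hψ _ hh', hψ _ hg, one_mul, one_smul,
      mul_add, hψa]
    congr 1
    exact (Algebra.commutes _ _).symm
  -- The vector `1` is fixed by the translation and has trivial annihilator, so the leading
  -- coefficient of the monic `p` would be zero.
  have := coeff_eq_zero_of_aeval_apply_eq_zero hne hβ (x := (1 : B)) (map_one (translate ψ))
    (fun r hr => Subtype.ext ((mul_one (r : B)).symm.trans hr)) p.natDegree p le_rfl hp1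
  rw [hmonic.coeff_natDegree] at this
  have : (1 : B) = 0 := congrArg Subtype.val this
  exact one_ne_zero (α := k) (by simpa using congrArg (Coalgebra.counit (R := k)) this)

/-- The quotient `χ'⁻¹ * χ` is trivial on group-likes. Hence it and the counit both vanish on the
generating skew primitives, so the two coincide. -/
theorem algHom_ext_of_isGroupLikeElem (hB : IsPointed k B) (hB₀ : HasCommutativeCoradical k B)
    (hgen : GeneratedByFiniteTypeSkewPrimitives k B) {χ χ' : B →ₐ[k] k}
    (h : ∀ g, IsGroupLikeElem k g → χ g = χ' g) : χ = χ' := by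
  have hψ : ∀ g, IsGroupLikeElem k g →
      (toConv (convInv χ') * toConv χ : WithConv (B →ₐ[k] k)).ofConv g = 1 := by
    intro g hg
    rw [conv_apply_of_isGroupLikeElem _ _ hg]
    change χ' (HopfAlgebra.antipode k g) * χ g = 1
    rw [h g hg, ← map_mul, hg.antipode_mul_cancel, map_one]
  have e : (toConv (convInv χ') * toConv χ : WithConv (B →ₐ[k] k)) = 1 := by
    apply WithConv.ext
    refine AlgHom.ext_of_adjoin_eq_top hgen fun a ha => ?_
    rw [ha.1.apply_eq_zero hB hB₀ hψ ha.2]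
    exact (ha.1.apply_eq_zero hB hB₀ (ψ := (1 : WithConv (B →ₐ[k] k)).ofConv)
      (fun g hg => by
        change algebraMap k k (Coalgebra.counit (R := k) g) = 1
        rw [hg.counit_eq_one, map_one]) ha.2).symm
  have := congrArg (fun f => toConv χ' * f) e
  simp only [← mul_assoc, mul_convInv, one_mul, mul_one] at this
  exact congrArg WithConv.ofConv this

theorem conv_comm (hB : IsPointed k B) (hB₀ : HasCommutativeCoradical k B)
    (hgen : GeneratedByFiniteTypeSkewPrimitives k B) (χ χ' : WithConv (B →ₐ[k] k)) :
    χ * χ' = χ' * χ := by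
  apply WithConv.ext
  refine algHom_ext_of_isGroupLikeElem hB hB₀ hgen fun g hg => ?_
  rw [conv_apply_of_isGroupLikeElem _ _ hg, conv_apply_of_isGroupLikeElem _ _ hg, mul_comm]

end Characters

end HopfSub
-- Twisting by a character that commutes with the values
namespace CocycleTwist

open WithConv

variable {k B : Type*} [Field k] [Ring B] [Bialgebra k B]

theorem scal_self {C : Type*} [AddCommGroup C] [Module k C] [Coalgebra k C]
    (f : WithConv (C →ₗ[k] k)) : scal k f = f := rfl

/-- If `σ ∘ h` is an algebra map commuting with the algebra map `χ`, then the twisted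
multiplication agrees with the original one wherever the latter factors through `χ`. -/
theorem apply_twistMul_of_commute (σ : (WithConv (B ⊗[k] B →ₗ[k] k))ˣ) {C : Type*} [Ring C]
    [Bialgebra k C] (h : C →ₗc[k] B ⊗[k] B) {t χ : C →ₐ[k] k}
    (ht : ∀ c, σ.val.ofConv (h c) = t c) (hcomm : toConv t * toConv χ = toConv χ * toConv t)
    {E : Type*} [Ring E] [Algebra k E] (Φ : B →ₗ[k] E) (Ψ : k →ₗ[k] E)
    (hΦ : ∀ c, Φ (LinearMap.mul' k B (h c)) = Ψ (χ c)) (c : C) :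
    Φ (twistMul σ (h c)) = Ψ (χ c) := by
  have e := congrArg (fun F => toConv (Φ ∘ₗ F.ofConv)) (twistMul_comp σ h)
  simp only [comp_mul_scal, comp_scal_mul] at e
  have h1 : Φ ∘ₗ LinearMap.mul' k B ∘ₗ h.toLinearMap =
      Ψ ∘ₗ (toConv χ.toLinearMap).ofConv := LinearMap.ext hΦ
  have h2 : (Units.map (pull k h) σ).val = toConv t.toLinearMap :=
    WithConv.ext (LinearMap.ext ht)
  have h3 : toConv t.toLinearMap * toConv χ.toLinearMap =
      toConv χ.toLinearMap * toConv t.toLinearMap :=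
    congrArg (fun F : WithConv (C →ₐ[k] k) => toConv F.ofConv.toLinearMap) hcomm
  -- The twisted product has become `t * χ * t⁻¹` composed with `Ψ`; swapping `t` and `χ` puts `t`
  -- next to its inverse.
  rw [h1, ← comp_scal_mul, ← comp_mul_scal, scal_self, scal_self, h2, h3, ← h2,
    mul_assoc, Units.mul_inv, mul_one] at e
  exact DFunLike.congr_fun (congrArg WithConv.ofConv e) c

/-- The coalgebra map `k → C` given by a group-like element of `C`. -/
def groupLikeCoalgHom {C : Type*} [AddCommGroup C] [Module k C] [Coalgebra k C] {g : C}
    (hg : IsGroupLikeElem k g) : k →ₗc[k] C where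
  __ := LinearMap.toSpanSingleton k C g
  counit_comp := by ext; simp [hg.counit_eq_one]
  map_comp_comul := by ext; simp [hg.comul_eq_tmul_self]

end CocycleTwist

namespace SkewPairing

open WithConv CocycleTwist

/-! ### Products with group-like elements in the twisted algebra -/

section Product

variable {k U A : Type*} [Field k] [Ring U] [Bialgebra k U] [Ring A] [Bialgebra k A]

variable (k U A) in
/-- The coalgebra map `a ⊗ u ↦ (1 ⊗ a) ⊗ (u ⊗ 1)`. -/
def inclAU : A ⊗[k] U →ₗc[k] (U ⊗[k] A) ⊗[k] (U ⊗[k] A) :=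
  Coalgebra.TensorProduct.map (coalgInclA k U A) (coalgInclU k U A)

theorem inclAU_tmul (a : A) (u : U) :
    inclAU k U A (a ⊗ₜ u) = ((1 : U) ⊗ₜ[k] a) ⊗ₜ[k] (u ⊗ₜ[k] (1 : A)) := by
  simp [inclAU, coalgInclA, coalgInclU]

variable (τ : SkewPairing k U A)

theorem inclA_mul_inclU (a : A) (u : U) :
    τ.inclA a * τ.inclU u = twistMul τ.sigma (inclAU k U A (a ⊗ₜ u)) := by
  rw [inclAU_tmul]
  rfl

theorem sigma_inclAU (a : A) (u : U) :
    τ.sigma.val.ofConv (inclAU k U A (a ⊗ₜ u)) = τ.form (u ⊗ₜ a) := by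
  rw [inclAU_tmul, sigma_tmul]
  simp

theorem mul'_inclAU (a : A) (u : U) :
    LinearMap.mul' k (U ⊗[k] A) (inclAU k U A (a ⊗ₜ u)) = u ⊗ₜ a := by
  rw [inclAU_tmul]
  simp

theorem form_mul_of_isGroupLikeElem_right {g : A} (hg : IsGroupLikeElem k g) (u u' : U) :
    τ.form ((u * u') ⊗ₜ g) = τ.form (u ⊗ₜ g) * τ.form (u' ⊗ₜ g) := by
  rw [form_mul_left]
  have := congrArg (LinearMap.mul' k k ∘ₗ TensorProduct.map
    (τ.form ∘ₗ TensorProduct.mk k U A u) (τ.form ∘ₗ TensorProduct.mk k U A u'))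
    ((Coalgebra.Repr.arbitrary k g).eq.trans hg.comul_eq_tmul_self)
  simpa using this

/-- The pairing reverses the tensor factors of `Δ(g)`, which is harmless because `Δ(g) = g ⊗ g`. -/
theorem form_mul_of_isGroupLikeElem_left {g : U} (hg : IsGroupLikeElem k g) (a a' : A) :
    τ.form (g ⊗ₜ (a * a')) = τ.form (g ⊗ₜ a) * τ.form (g ⊗ₜ a') := by
  rw [form_mul_right]
  have := congrArg (LinearMap.mul' k k ∘ₗ TensorProduct.map
    (τ.form ∘ₗ (TensorProduct.mk k U A).flip a') (τ.form ∘ₗ (TensorProduct.mk k U A).flip a))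
    ((Coalgebra.Repr.arbitrary k g).eq.trans hg.comul_eq_tmul_self)
  simpa [mul_comm] using this

/-- The algebra map `u ↦ τ(u, g)` for a group-like element `g` of `A`. -/
def formRight {g : A} (hg : IsGroupLikeElem k g) : U →ₐ[k] k :=
  AlgHom.ofLinearMap (τ.form ∘ₗ (TensorProduct.mk k U A).flip g)
    ((τ.form_one_left g).trans hg.counit_eq_one) (τ.form_mul_of_isGroupLikeElem_right hg)

/-- The algebra map `a ↦ τ(g, a)` for a group-like element `g` of `U`. -/
def formLeft {g : U} (hg : IsGroupLikeElem k g) : A →ₐ[k] k :=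
  AlgHom.ofLinearMap (τ.form ∘ₗ TensorProduct.mk k U A g)
    ((τ.form_one_right g).trans hg.counit_eq_one) (τ.form_mul_of_isGroupLikeElem_left hg)

/-- With `t = τ(-, g)`, the left side is `χ(g) (t * ρ * t⁻¹)(u)`, and `t` commutes with `ρ`. -/
theorem apply_idTensor_mul_of_isGroupLikeElem
    (hcomm : ∀ ρ ρ' : WithConv (U →ₐ[k] k), ρ * ρ' = ρ' * ρ) (ρ : U →ₐ[k] k) (χ : A →ₐ[k] k)
    {g : A} (hg : IsGroupLikeElem k g) (u : U) :
    ρ (τ.idTensor χ (τ.inclA g * τ.inclU u)) = χ g * ρ u := by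
  -- The map `v ↦ (1 ⊗ g) ⊗ (v ⊗ 1)` respects comultiplication because `g` is group-like.
  let h : U →ₗc[k] (U ⊗[k] A) ⊗[k] (U ⊗[k] A) := (inclAU k U A).comp
    ((Coalgebra.TensorProduct.map (groupLikeCoalgHom hg) (CoalgHom.id k U)).comp
      (Coalgebra.TensorProduct.lid k U).symm.toCoalgHom)
  have hh : ∀ v, h v = inclAU k U A (g ⊗ₜ v) := fun v => by
    simp [h, groupLikeCoalgHom]
  have e := apply_twistMul_of_commute τ.sigma h (t := τ.formRight hg) (χ := ρ)
    (fun v => by rw [hh, sigma_inclAU]; rfl) (hcomm _ _)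
    (ρ.toLinearMap ∘ₗ τ.idTensor χ) (χ g • LinearMap.id)
    (fun v => by
      rw [hh, mul'_inclAU]
      change ρ (τ.idTensor χ (τ.tmul v g)) = χ g * ρ v
      rw [idTensor_tmul, map_smul, smul_eq_mul]) u
  rw [inclA_mul_inclU, ← hh]
  exact e

/-- Conjugation by the character `τ(g, -)` of `A` leaves `χ` unchanged. It follows that `g` in `U_χ`
is again a vector of weight `χ`. -/
theorem idTensor_mul_of_isGroupLikeElem
    (hcomm : ∀ χ χ' : WithConv (A →ₐ[k] k), χ * χ' = χ' * χ) (χ : A →ₐ[k] k)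
    {g : U} (hg : IsGroupLikeElem k g) (a : A) :
    τ.idTensor χ (τ.inclA a * τ.inclU g) = χ a • g := by
  let h : A →ₗc[k] (U ⊗[k] A) ⊗[k] (U ⊗[k] A) := (inclAU k U A).comp
    ((Coalgebra.TensorProduct.map (CoalgHom.id k A) (groupLikeCoalgHom hg)).comp
      (Coalgebra.TensorProduct.rid k k A).symm.toCoalgHom)
  have hh : ∀ b, h b = inclAU k U A (b ⊗ₜ g) := fun v => by
    simp [h, groupLikeCoalgHom]
  have e := apply_twistMul_of_commute τ.sigma h (t := τ.formLeft hg) (χ := χ)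
    (fun v => by rw [hh, sigma_inclAU]; rfl) (hcomm _ _)
    (τ.idTensor χ) (LinearMap.toSpanSingleton k U g)
    (fun v => by rw [hh, mul'_inclAU]; rfl) a
  rw [inclA_mul_inclU, ← hh]
  exact e

theorem inclU_mul_inclA (u : U) (a : A) : τ.inclU u * τ.inclA a = τ.tmul u a := by
  change τ.mulH (τ.tmul u 1) (τ.tmul 1 a) = _
  rw [mulH_one_left, one_mul]

end Product

/-! ### Modules with a weight vector and a weight functional -/

section Weights

variable {k U A : Type*} [Field k] [Ring U] [Bialgebra k U] [Ring A] [Bialgebra k A]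
variable (τ : SkewPairing k U A)
variable {M : Type*} [AddCommGroup M] [Module k M] [Module τ.H M] [IsScalarTower k τ.H M]

/-- The vector `m` spans an `A`-submodule with character `χ` and generates `M`, and the kernel of
the functional `f` is a `U`-submodule with character `ρ` on the quotient which contains no nonzero
`H`-submodule. -/
structure HasWeights (ρ : U →ₐ[k] k) (χ : A →ₐ[k] k) (m : M) (f : M →ₗ[k] k) : Prop where
  inclA_smul : ∀ a, τ.inclA a • m = χ a • m
  apply_inclU_smul : ∀ u x, f (τ.inclU u • x) = ρ u * f x
  span_eq_top : Submodule.span τ.H {m} = ⊤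
  eq_bot : ∀ W : Submodule τ.H M, (∀ x ∈ W, f x = 0) → W = ⊥
  apply_eq_one : f m = 1

/-- Since `u ⊗ a = (u ⊗ 1)(1 ⊗ a)`, the `A`-part is absorbed by the weight. Consequently `H m = U m`
for every `A`-weight vector. -/
theorem smul_eq_inclU_smul {χ : A →ₐ[k] k} {m : M} (h : ∀ a, τ.inclA a • m = χ a • m)
    (y : τ.H) : y • m = τ.inclU (τ.idTensor χ y) • m := by
  refine τ.tmul_induction (p := fun y => y • m = τ.inclU (τ.idTensor χ y) • m) y ?_
    (fun u a => ?_) (fun x y hx hy => ?_)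
  · simp
  · rw [idTensor_tmul, ← inclU_mul_inclA, mul_smul, h, map_smul, smul_assoc, smul_comm]
  · rw [add_smul, hx, hy, map_add, map_add, add_smul]

variable {τ} in
/-- The `H`-linear map `U_χ → M`, `u ↦ u m`, given by a vector `m` of weight `χ`. -/
def indHom {χ : A →ₐ[k] k} {m : M} (h : ∀ a, τ.inclA a • m = χ a • m) : τ.Ind χ →ₗ[τ.H] M where
  toFun x := τ.inclU ((τ.toInd χ).symm x) • m
  map_add' x y := by rw [map_add, map_add, add_smul]
  map_smul' y x := by
    rw [RingHom.id_apply, ← mul_smul, τ.smul_eq_inclU_smul h (y * _)]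
    rfl

variable {τ} in
theorem indHom_toInd {χ : A →ₐ[k] k} {m : M} (h : ∀ a, τ.inclA a • m = χ a • m) (u : U) :
    indHom h (τ.toInd χ u) = τ.inclU u • m := rfl

theorem inclA_smul_toInd (χ : A →ₐ[k] k) (a : A) (u : U) :
    τ.inclA a • τ.toInd χ u = τ.toInd χ (τ.idTensor χ (τ.inclA a * τ.inclU u)) := rfl

theorem inclU_smul_toInd (χ : A →ₐ[k] k) (u u' : U) :
    τ.inclU u • τ.toInd χ u' = τ.toInd χ (u * u') := by
  change τ.toInd χ (τ.idTensor χ (τ.inclU u * τ.inclU u')) = _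
  rw [← map_mul]
  change τ.toInd χ (χ 1 • (u * u')) = _
  rw [map_one, one_smul]

theorem apply_eq_zero_of_mem_maxSub {ρ : U →ₐ[k] k} {χ : A →ₐ[k] k} {x : τ.Ind χ}
    (hx : x ∈ τ.maxSub ρ χ) : ρ ((τ.toInd χ).symm x) = 0 := by
  rw [maxSub, sSup_eq_iSup'] at hx
  refine Submodule.iSup_induction _
    (motive := fun x => ρ ((τ.toInd χ).symm x) = 0) hx ?_ ?_ ?_
  · exact fun W x hx => W.2 x hx
  · rw [map_zero, map_zero]
  · intro x y hx hy
    rw [map_add, map_add, hx, hy, add_zero]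

theorem le_maxSub {ρ : U →ₐ[k] k} {χ : A →ₐ[k] k} {W : Submodule τ.H (τ.Ind χ)}
    (hW : ∀ x ∈ W, ρ ((τ.toInd χ).symm x) = 0) : W ≤ τ.maxSub ρ χ := le_sSup hW

namespace HasWeights

variable {τ} {ρ ρ' : U →ₐ[k] k} {χ χ' : A →ₐ[k] k} {m m' : M} {f f' : M →ₗ[k] k}

theorem exists_inclU_smul_eq (h : τ.HasWeights ρ χ m f) (x : M) : ∃ u, τ.inclU u • m = x := by
  obtain ⟨y, rfl⟩ := Submodule.mem_span_singleton.1 (h.span_eq_top ▸ Submodule.mem_top : x ∈ _)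
  exact ⟨_, (τ.smul_eq_inclU_smul h.inclA_smul y).symm⟩

theorem apply_inclU_smul_self (h : τ.HasWeights ρ χ m f) (u : U) : f (τ.inclU u • m) = ρ u := by
  rw [h.apply_inclU_smul, h.apply_eq_one, mul_one]

/-- A vector of some weight for `A` in the kernel of the functional is zero. -/
theorem eq_zero_of_apply_eq_zero (h : τ.HasWeights ρ χ m f) {x : M}
    (hx : ∀ a, τ.inclA a • x = χ' a • x) (hfx : f x = 0) : x = 0 := by
  refine Submodule.span_singleton_eq_bot.1 (h.eq_bot (Submodule.span τ.H {x}) fun z hz => ?_)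
  obtain ⟨y, rfl⟩ := Submodule.mem_span_singleton.1 hz
  rw [τ.smul_eq_inclU_smul hx, h.apply_inclU_smul, hfx, mul_zero]

/-- The map `U_χ → M` pulls `f` back to `ρ`. So its kernel lies in `Ker ρ`, and the image of `I(ρ,
χ)` is an `H`-submodule of `ker f`, hence zero. -/
theorem ker_indHom (h : τ.HasWeights ρ χ m f) :
    LinearMap.ker (indHom h.inclA_smul) = τ.maxSub ρ χ := by
  have hf : ∀ x : τ.Ind χ, f (indHom h.inclA_smul x) = ρ ((τ.toInd χ).symm x) :=
    fun x => h.apply_inclU_smul_self _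
  refine le_antisymm (τ.le_maxSub fun x hx => ?_) fun x hx => ?_
  · rw [← hf, LinearMap.mem_ker.1 hx, map_zero]
  · have hbot := h.eq_bot ((τ.maxSub ρ χ).map (indHom h.inclA_smul)) (by
      rintro _ ⟨y, hy, rfl⟩
      rw [hf, τ.apply_eq_zero_of_mem_maxSub hy])
    exact (Submodule.eq_bot_iff _).1 hbot _ ⟨x, hx, rfl⟩

theorem nonempty_equiv_L (h : τ.HasWeights ρ χ m f) : Nonempty (M ≃ₗ[τ.H] τ.L ρ χ) := by
  have hs : Function.Surjective (indHom h.inclA_smul) := fun x =>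
    (h.exists_inclU_smul_eq x).imp fun u hu => hu
  exact ⟨((Submodule.quotEquivOfEq _ _ h.ker_indHom).symm.trans
    ((indHom h.inclA_smul).quotKerEquivOfSurjective hs)).symm⟩

theorem map {M' : Type*} [AddCommGroup M'] [Module k M'] [Module τ.H M'] [IsScalarTower k τ.H M']
    (h : τ.HasWeights ρ χ m f) (e : M ≃ₗ[τ.H] M') :
    τ.HasWeights ρ χ (e m) (f ∘ₗ (e.symm.restrictScalars k).toLinearMap) where
  inclA_smul a := by
    rw [← map_smul, h.inclA_smul]
    exact map_smul (e.restrictScalars k) _ _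
  apply_inclU_smul u x := by
    change f (e.symm _) = _ * f (e.symm _)
    rw [map_smul, h.apply_inclU_smul]
  span_eq_top := by
    have := congrArg (Submodule.map e.toLinearMap) h.span_eq_top
    rw [Submodule.map_span, Set.image_singleton, Submodule.map_top, LinearEquiv.range] at this
    exact this
  eq_bot W hW := by
    have := h.eq_bot (W.comap e.toLinearMap) (fun x hx => by
      have := hW _ hx
      change f (e.symm (e x)) = 0 at this
      rwa [e.symm_apply_apply] at this)
    rw [Submodule.eq_bot_iff] at this ⊢
    intro x hx
    have := this (e.symm x) (by
      change e (e.symm x) ∈ W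
      rwa [e.apply_symm_apply])
    rwa [LinearEquiv.map_eq_zero_iff] at this
  apply_eq_one := by
    change f (e.symm (e m)) = 1
    rw [e.symm_apply_apply, h.apply_eq_one]

/-- Group-like elements of `A` act on the weight functional through `χ`. -/
theorem apply_inclA_smul (hcomm : ∀ ρ ρ' : WithConv (U →ₐ[k] k), ρ * ρ' = ρ' * ρ)
    (h : τ.HasWeights ρ χ m f) {g : A} (hg : IsGroupLikeElem k g) (x : M) :
    f (τ.inclA g • x) = χ g * f x := by
  obtain ⟨u, rfl⟩ := h.exists_inclU_smul_eq x
  rw [← indHom_toInd h.inclA_smul, ← map_smul, inclA_smul_toInd, indHom_toInd, indHom_toInd,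
    h.apply_inclU_smul_self, h.apply_inclU_smul_self,
    τ.apply_idTensor_mul_of_isGroupLikeElem hcomm ρ χ hg]

/-- Group-like elements of `U` act on the weight vector through `ρ`. -/
theorem inclU_smul (hcomm : ∀ χ χ' : WithConv (A →ₐ[k] k), χ * χ' = χ' * χ)
    (h : τ.HasWeights ρ χ m f) {g : U} (hg : IsGroupLikeElem k g) :
    τ.inclU g • m = ρ g • m := by
  -- The vector `g m - ρ(g) m` has weight `χ` and is killed by `f`.
  refine sub_eq_zero.1 (h.eq_zero_of_apply_eq_zero (χ' := χ) (fun a => ?_) ?_)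
  · rw [smul_sub, smul_sub, smul_comm _ (ρ g), h.inclA_smul, smul_comm (ρ g)]
    congr 1
    rw [← indHom_toInd h.inclA_smul, ← map_smul, inclA_smul_toInd, indHom_toInd, indHom_toInd,
      τ.idTensor_mul_of_isGroupLikeElem hcomm χ hg, map_smul, smul_assoc]
  · rw [map_sub, h.apply_inclU_smul_self, map_smul, h.apply_eq_one, smul_eq_mul, mul_one,
      sub_self]

/-- The weight vector is unique up to scalars, if algebra maps are determined by their values on
group-like elements. -/
theorem eq_smul_of_inclA_smul (hcomm : ∀ ρ ρ' : WithConv (U →ₐ[k] k), ρ * ρ' = ρ' * ρ)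
    (hext : ∀ χ χ' : A →ₐ[k] k, (∀ g, IsGroupLikeElem k g → χ g = χ' g) → χ = χ')
    (h : τ.HasWeights ρ χ m f) {x : M} (hx0 : x ≠ 0) (hx : ∀ a, τ.inclA a • x = χ' a • x) :
    χ' = χ ∧ x = f x • m := by
  have hfx : f x ≠ 0 := fun h0 => hx0 (h.eq_zero_of_apply_eq_zero hx h0)
  -- Computing `f(g x)` in two ways gives `χ'(g) f(x) = χ(g) f(x)` for group-like `g`.
  have hχ : χ' = χ := hext _ _ fun g hg => by
    have := h.apply_inclA_smul hcomm hg x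
    rw [hx, map_smul, smul_eq_mul] at this
    exact mul_right_cancel₀ hfx this
  refine ⟨hχ, sub_eq_zero.1 (h.eq_zero_of_apply_eq_zero (χ' := χ) (fun a => ?_) ?_)⟩
  · rw [smul_sub, hx, smul_comm _ (f x), h.inclA_smul, hχ, smul_sub, smul_comm (f x)]
  · rw [map_sub, map_smul, h.apply_eq_one, smul_eq_mul, mul_one, sub_self]

/-- The weight functional is unique up to scalars, if algebra maps are determined by their values
on group-like elements. -/
theorem eq_smul_of_apply_inclU_smul (hcomm : ∀ χ χ' : WithConv (A →ₐ[k] k), χ * χ' = χ' * χ)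
    (hext : ∀ ρ ρ' : U →ₐ[k] k, (∀ g, IsGroupLikeElem k g → ρ g = ρ' g) → ρ = ρ')
    (h : τ.HasWeights ρ χ m f) (hf0 : f' ≠ 0)
    (hf : ∀ u x, f' (τ.inclU u • x) = ρ' u * f' x) :
    ρ' = ρ ∧ f' m ≠ 0 ∧ f' = f' m • f := by
  have hfm : f' m ≠ 0 := fun h0 => hf0 <| LinearMap.ext fun x => by
    obtain ⟨u, rfl⟩ := h.exists_inclU_smul_eq x
    rw [hf, h0, mul_zero, LinearMap.zero_apply]
  -- Computing `f'(g m)` in two ways: through the weight of `f'`, and through the action of `g` on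
  -- `m`.
  have hρ : ρ' = ρ := hext _ _ fun g hg => by
    have := hf g m
    rw [h.inclU_smul hcomm hg, map_smul, smul_eq_mul] at this
    exact (mul_right_cancel₀ hfm this).symm
  refine ⟨hρ, hfm, LinearMap.ext fun x => ?_⟩
  obtain ⟨u, rfl⟩ := h.exists_inclU_smul_eq x
  rw [hf, LinearMap.smul_apply, h.apply_inclU_smul_self, hρ, smul_eq_mul, mul_comm]

theorem isObject (h : τ.HasWeights ρ χ m f) : τ.IsObject M where
  exists_line := by
    refine ⟨k ∙ m, fun a x hx => ?_, ?_, ?_⟩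
    · obtain ⟨r, rfl⟩ := Submodule.mem_span_singleton.1 hx
      rw [smul_comm, h.inclA_smul]
      exact Submodule.smul_mem _ _ (Submodule.smul_mem _ _ (Submodule.mem_span_singleton_self m))
    · refine finrank_span_singleton fun h0 => one_ne_zero (α := k) ?_
      rw [← h.apply_eq_one, h0, map_zero]
    · refine top_le_iff.1 (h.span_eq_top ▸ Submodule.span_mono ?_)
      exact Set.singleton_subset_iff.2 (Submodule.mem_span_singleton_self m)
  exists_hyperplane := by
    refine ⟨LinearMap.ker f, fun u x hx => ?_, ?_, fun W hW => h.eq_bot W fun x hx => hW hx⟩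
    · rw [LinearMap.mem_ker] at hx ⊢
      rw [h.apply_inclU_smul, hx, mul_zero]
    · have hs : Function.Surjective f := fun r =>
        ⟨r • m, by rw [map_smul, h.apply_eq_one, smul_eq_mul, mul_one]⟩
      rw [(f.quotKerEquivOfSurjective hs).finrank_eq, Module.finrank_self]

end HasWeights

/-! ### Characters on lines and hyperplanes -/

/-- An algebra acts on a stable line through a character. -/
theorem exists_character_of_line {R : Type*} [Ring R] [Algebra k R] (φ : R →ₐ[k] Module.End k M)
    {V : Submodule k M} (hV : ∀ r, ∀ x ∈ V, φ r x ∈ V) (h1 : Module.finrank k V = 1) :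
    ∃ (m : M) (χ : R →ₐ[k] k), m ≠ 0 ∧ V = k ∙ m ∧ ∀ r, φ r m = χ r • m := by
  obtain ⟨⟨m, hm⟩, hm0, hspan⟩ := finrank_eq_one_iff'.1 h1
  have hm0' : m ≠ 0 := fun h => hm0 (Subtype.ext h)
  have hspan' : ∀ x ∈ V, ∃ c : k, c • m = x := fun x hx =>
    (hspan ⟨x, hx⟩).imp fun c hc => congrArg Subtype.val hc
  choose χ hχ using fun r => hspan' _ (hV r m hm)
  -- Each algebra map identity for `χ` is checked after applying both sides to `m`.
  have hinj : Function.Injective fun c : k => c • m := smul_left_injective k hm0'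
  refine ⟨m, AlgHom.ofLinearMap ⟨⟨χ, fun r s => hinj ?_⟩, fun c r => hinj ?_⟩ (hinj ?_)
    (fun r s => hinj ?_), hm0', le_antisymm (fun x hx => ?_) ?_, fun r => (hχ r).symm⟩
  · simp only [add_smul, hχ, map_add, LinearMap.add_apply]
  · simp only [RingHom.id_apply, smul_eq_mul, mul_smul, hχ, map_smul, LinearMap.smul_apply]
  · change χ 1 • m = (1 : k) • m
    rw [hχ, map_one, one_smul, Module.End.one_apply]
  · change χ (r * s) • m = (χ r * χ s) • m
    rw [hχ, map_mul, Module.End.mul_apply, ← hχ s, map_smul, ← hχ r, smul_smul, mul_comm]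
  · exact Submodule.mem_span_singleton.2 (hspan' x hx)
  · exact (Submodule.span_singleton_le_iff_mem _ _).2 hm

/-- An algebra acts on the quotient by a stable hyperplane through a character. -/
theorem exists_character_of_hyperplane {R : Type*} [Ring R] [Algebra k R]
    (φ : R →ₐ[k] Module.End k M) {N : Submodule k M} (hN : ∀ r, ∀ x ∈ N, φ r x ∈ N)
    (h1 : Module.finrank k (M ⧸ N) = 1) :
    ∃ (f : M →ₗ[k] k) (ρ : R →ₐ[k] k), f ≠ 0 ∧ LinearMap.ker f = N ∧
      ∀ r x, f (φ r x) = ρ r * f x := by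
  have : Module.Finite k (M ⧸ N) := Module.finite_of_finrank_pos (by omega)
  let e : (M ⧸ N) ≃ₗ[k] k := LinearEquiv.ofFinrankEq _ _ (h1.trans (Module.finrank_self k).symm)
  let f : M →ₗ[k] k := e.toLinearMap ∘ₗ N.mkQ
  have hker : LinearMap.ker f = N := by
    rw [LinearMap.ker_comp_of_ker_eq_bot _ e.ker, Submodule.ker_mkQ]
  obtain ⟨x₀, hx₀⟩ : ∃ x, f x = 1 := (e.surjective.comp N.mkQ_surjective) 1
  have key : ∀ r x, f (φ r x) = f (φ r x₀) * f x := fun r x => by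
    -- Modulo `N` every `x` is `f(x) x₀`, so the character has to be `r ↦ f(r x₀)`.
    have hx : x - f x • x₀ ∈ N := by
      rw [← hker, LinearMap.mem_ker, map_sub, map_smul, hx₀, smul_eq_mul, mul_one, sub_self]
    have := hN r _ hx
    rw [← hker, LinearMap.mem_ker, map_sub, map_smul, map_sub, map_smul, smul_eq_mul,
      sub_eq_zero] at this
    rw [this, mul_comm]
  refine ⟨f, AlgHom.ofLinearMap (f ∘ₗ LinearMap.applyₗ x₀ ∘ₗ φ.toLinearMap) ?_ fun r s => ?_,
    fun h => ?_, hker, key⟩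
  · change f (φ 1 x₀) = 1
    rw [map_one, Module.End.one_apply, hx₀]
  · change f (φ (r * s) x₀) = f (φ r x₀) * f (φ s x₀)
    rw [map_mul, Module.End.mul_apply, key]
  · rw [h, LinearMap.zero_apply] at hx₀
    exact zero_ne_one hx₀

variable {τ} in
theorem IsASubmodule.exists_character {V : Submodule k M}
    (hV : τ.IsASubmodule V) (h1 : Module.finrank k V = 1) :
    ∃ (m : M) (χ : A →ₐ[k] k), m ≠ 0 ∧ V = k ∙ m ∧ ∀ a, τ.inclA a • m = χ a • m :=
  exists_character_of_line ((Algebra.lsmul k k M).comp τ.inclA) hV h1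

variable {τ} in
theorem IsUSubmodule.exists_character {N : Submodule k M}
    (hN : τ.IsUSubmodule N) (h1 : Module.finrank k (M ⧸ N) = 1) :
    ∃ (f : M →ₗ[k] k) (ρ : U →ₐ[k] k), f ≠ 0 ∧ LinearMap.ker f = N ∧
      ∀ u x, f (τ.inclU u • x) = ρ u * f x :=
  exists_character_of_hyperplane ((Algebra.lsmul k k M).comp τ.inclU) hN h1

variable {τ} in
theorem IsObject.exists_hasWeights (h : τ.IsObject M) :
    ∃ (ρ : U →ₐ[k] k) (χ : A →ₐ[k] k) (m : M) (f : M →ₗ[k] k), τ.HasWeights ρ χ m f := by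
  obtain ⟨V, hV, hV1, hgen⟩ := h.exists_line
  obtain ⟨N, hN, hN1, hbot⟩ := h.exists_hyperplane
  obtain ⟨m, χ, -, rfl, hm⟩ := hV.exists_character hV1
  obtain ⟨f, ρ, hf0, rfl, hf⟩ := hN.exists_character hN1
  have hspan : Submodule.span τ.H {m} = ⊤ := by
    refine top_le_iff.1 (hgen ▸ Submodule.span_le.2 fun x hx => ?_)
    obtain ⟨r, rfl⟩ := Submodule.mem_span_singleton.1 hx
    rw [SetLike.mem_coe, ← algebraMap_smul τ.H r m]
    exact Submodule.smul_mem _ _ (Submodule.mem_span_singleton_self m)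
  have hfm : f m ≠ 0 := fun h0 => hf0 <| LinearMap.ext fun x => by
    obtain ⟨y, rfl⟩ := Submodule.mem_span_singleton.1 (hspan ▸ Submodule.mem_top : x ∈ _)
    rw [τ.smul_eq_inclU_smul hm, hf, h0, mul_zero, LinearMap.zero_apply]
  -- Rescaling normalises the functional to the value `1` on `m`; its weight and kernel do not
  -- change.
  refine ⟨ρ, χ, m, (f m)⁻¹ • f, hm, fun u x => ?_, hspan, fun W hW => hbot W fun x hx => ?_, ?_⟩
  · rw [LinearMap.smul_apply, LinearMap.smul_apply, hf, smul_eq_mul, smul_eq_mul, mul_left_comm]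
  · have := hW x hx
    rw [LinearMap.smul_apply, smul_eq_zero] at this
    exact this.resolve_left (inv_ne_zero hfm)
  · rw [LinearMap.smul_apply, smul_eq_mul, inv_mul_cancel₀ hfm]

end Weights

end SkewPairing
namespace SkewPairing

/-! ### `L(ρ, χ)` carries weights `ρ` and `χ` -/

section Quotient

variable {k U A : Type*} [Field k] [Ring U] [Bialgebra k U] [Ring A] [Bialgebra k A]
variable (τ : SkewPairing k U A)

/-- Scalars act through `H`, which makes the scalar tower immediate; `toInd_smul` recovers the
original scalar action on `U`. -/
instance instModuleIndBase (χ : A →ₐ[k] k) : Module k (τ.Ind χ) :=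
  Module.compHom _ (algebraMap k τ.H)

instance instIsScalarTowerInd (χ : A →ₐ[k] k) : IsScalarTower k τ.H (τ.Ind χ) :=
  ⟨fun r y x => by
    rw [Algebra.smul_def, mul_smul]
    rfl⟩

theorem toInd_smul (χ : A →ₐ[k] k) (r : k) (u : U) :
    τ.toInd χ (r • u) = r • τ.toInd χ u := by
  change _ = algebraMap k τ.H r • τ.toInd χ u
  rw [← AlgHom.commutes τ.inclU, inclU_smul_toInd, Algebra.smul_def]

/-- The functional on `L(ρ, χ)` induced by `ρ`. -/
def functionalL (ρ : U →ₐ[k] k) (χ : A →ₐ[k] k) : τ.L ρ χ →ₗ[k] k :=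
  ((τ.maxSub ρ χ).restrictScalars k).liftQ
    { toFun := fun x => ρ ((τ.toInd χ).symm x)
      map_add' := fun x y => by rw [map_add, map_add]
      map_smul' := fun r x => by
        obtain ⟨u, rfl⟩ := (τ.toInd χ).surjective x
        rw [← toInd_smul, AddEquiv.symm_apply_apply, AddEquiv.symm_apply_apply, map_smul,
          RingHom.id_apply] }
    fun _ hx => τ.apply_eq_zero_of_mem_maxSub hx

theorem functionalL_mk (ρ : U →ₐ[k] k) (χ : A →ₐ[k] k) (u : U) :
    τ.functionalL ρ χ ((τ.maxSub ρ χ).mkQ (τ.toInd χ u)) = ρ u := rfl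

theorem hasWeights_L (ρ : U →ₐ[k] k) (χ : A →ₐ[k] k) :
    τ.HasWeights ρ χ ((τ.maxSub ρ χ).mkQ (τ.toInd χ 1)) (τ.functionalL ρ χ) where
  inclA_smul a := by
    have h1 : τ.inclA a • τ.toInd χ 1 = χ a • τ.toInd χ 1 := by
      rw [inclA_smul_toInd, map_one, mul_one, ← toInd_smul]
      rfl
    rw [← map_smul, h1]
    rfl
  apply_inclU_smul u x := by
    obtain ⟨x, rfl⟩ := (τ.maxSub ρ χ).mkQ_surjective x
    obtain ⟨v, rfl⟩ := (τ.toInd χ).surjective x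
    rw [← map_smul, inclU_smul_toInd, functionalL_mk, functionalL_mk, map_mul]
  span_eq_top := by
    refine Submodule.eq_top_iff'.2 fun x => ?_
    obtain ⟨x, rfl⟩ := (τ.maxSub ρ χ).mkQ_surjective x
    obtain ⟨v, rfl⟩ := (τ.toInd χ).surjective x
    refine Submodule.mem_span_singleton.2 ⟨τ.inclU v, ?_⟩
    rw [← map_smul, inclU_smul_toInd, mul_one]
  eq_bot W hW := by
    -- The preimage in `U_χ` of a submodule killed by the functional lies in `Ker ρ`, so maximality
    -- of `I(ρ, χ)` applies.
    have hle : W.comap (τ.maxSub ρ χ).mkQ ≤ τ.maxSub ρ χ := τ.le_maxSub fun x hx => hW _ hx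
    refine (Submodule.eq_bot_iff _).2 fun x hx => ?_
    obtain ⟨x, rfl⟩ := (τ.maxSub ρ χ).mkQ_surjective x
    exact (Submodule.Quotient.mk_eq_zero _).2 (hle hx)
  apply_eq_one := by rw [functionalL_mk, map_one]

end Quotient

end SkewPairing

/-! ### Finite-dimensional irreducible modules -/

namespace FiniteDimensionalIrreduciblesAreLines

variable {k : Type*} [Field k] {R : Type u} [Ring R] [Algebra k R]

/-- A simple module is some `R ⧸ I`, which lives in the universe of `R`, where the hypothesis
applies. -/
theorem finrank_eq_one (h : FiniteDimensionalIrreduciblesAreLines k R) {V : Type*}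
    [AddCommGroup V] [Module k V] [Module R V] [IsScalarTower k R V] [FiniteDimensional k V]
    [IsSimpleModule R V] : Module.finrank k V = 1 := by
  obtain ⟨I, hI, ⟨e⟩⟩ := isSimpleModule_iff_quot_maximal.1 ‹IsSimpleModule R V›
  let e' : V ≃ₗ[k] R ⧸ I := e.restrictScalars k
  have := e'.finiteDimensional
  have := IsSimpleModule.congr e.symm
  rw [e'.finrank_eq]
  exact h (R ⧸ I)

variable {M : Type*} [AddCommGroup M] [Module k M] [Module R M] [IsScalarTower k R M]
  [FiniteDimensional k M]

theorem exists_line (h : FiniteDimensionalIrreduciblesAreLines k R) [Nontrivial M] :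
    ∃ V : Submodule R M, Module.finrank k V = 1 := by
  have : IsArtinian R M := isArtinian_of_tower k inferInstance
  obtain ⟨V, hV⟩ := IsAtomic.exists_atom (Submodule R M)
  have := isSimpleModule_iff_isAtom.2 hV
  have : FiniteDimensional k V :=
    inferInstanceAs (FiniteDimensional k (V.restrictScalars k))
  exact ⟨V, h.finrank_eq_one⟩

theorem exists_hyperplane (h : FiniteDimensionalIrreduciblesAreLines k R) [Nontrivial M] :
    ∃ N : Submodule R M, Module.finrank k (M ⧸ N) = 1 := by
  have : IsNoetherian R M := isNoetherian_of_tower k inferInstance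
  obtain ⟨N, hN⟩ := IsCoatomic.exists_coatom (Submodule R M)
  have := isSimpleModule_iff_isCoatom.2 hN
  have : FiniteDimensional k (M ⧸ N) :=
    inferInstanceAs (FiniteDimensional k (M ⧸ N.restrictScalars k))
  exact ⟨N, h.finrank_eq_one⟩

end FiniteDimensionalIrreduciblesAreLines

namespace SkewPairing

section Irreducible

variable {k : Type*} [Field k] {U : Type u} [Ring U] [Bialgebra k U] {A : Type v} [Ring A]
  [Bialgebra k A] (τ : SkewPairing k U A)
variable {M : Type*} [AddCommGroup M] [Module k M] [Module τ.H M] [IsScalarTower k τ.H M]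
  [FiniteDimensional k M]

/-- A nonzero finite-dimensional `A`-module has a minimal submodule, which is simple and hence a
line. -/
theorem exists_line_le (hA : FiniteDimensionalIrreduciblesAreLines k A) {W : Submodule k M}
    (hW : τ.IsASubmodule W) (hW0 : W ≠ ⊥) :
    ∃ V ≤ W, τ.IsASubmodule V ∧ Module.finrank k V = 1 := by
  let _ : Module A M := Module.compHom M τ.inclA.toRingHom
  have : IsScalarTower k A M := ⟨fun r a x => by
    change τ.inclA (r • a) • x = r • τ.inclA a • x
    rw [map_smul, smul_assoc]⟩
  let W' : Submodule A M := { W with smul_mem' := hW }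
  have : FiniteDimensional k W' := inferInstanceAs (FiniteDimensional k W)
  have : Nontrivial W' := W.nontrivial_iff_ne_bot.2 hW0
  obtain ⟨V, hV⟩ := hA.exists_line (M := W')
  refine ⟨(V.map W'.subtype).restrictScalars k, ?_, fun a x hx => ?_, ?_⟩
  · rintro _ ⟨x, -, rfl⟩
    exact x.2
  · exact (V.map W'.subtype).smul_mem a hx
  · rw [← hV]
    exact ((Submodule.equivMapOfInjective W'.subtype W'.subtype_injective V).restrictScalars
      k).finrank_eq.symm

theorem exists_hyperplane (hU : FiniteDimensionalIrreduciblesAreLines k U) [Nontrivial M] :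
    ∃ N : Submodule k M, τ.IsUSubmodule N ∧ Module.finrank k (M ⧸ N) = 1 := by
  let _ : Module U M := Module.compHom M τ.inclU.toRingHom
  have : IsScalarTower k U M := ⟨fun r a x => by
    change τ.inclU (r • a) • x = r • τ.inclU a • x
    rw [map_smul, smul_assoc]⟩
  obtain ⟨N, hN⟩ := hU.exists_hyperplane (M := M)
  exact ⟨N.restrictScalars k, fun u x hx => N.smul_mem u hx, hN⟩

theorem isObject_of_isSimpleModule (hU : FiniteDimensionalIrreduciblesAreLines k U)
    (hA : FiniteDimensionalIrreduciblesAreLines k A) [IsSimpleModule τ.H M] : τ.IsObject M := by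
  have : Nontrivial M := IsSimpleModule.nontrivial τ.H M
  obtain ⟨V, -, hV, hV1⟩ := τ.exists_line_le hA (W := (⊤ : Submodule k M))
    (fun _ _ _ => Submodule.mem_top) top_ne_bot
  obtain ⟨N, hN, hN1⟩ := τ.exists_hyperplane hU (M := M)
  refine ⟨⟨V, hV, hV1, (eq_bot_or_eq_top _).resolve_left fun h => ?_⟩,
    ⟨N, hN, hN1, fun W hW => (eq_bot_or_eq_top _).resolve_right fun h => ?_⟩⟩
  · have : V = ⊥ := (Submodule.eq_bot_iff _).2 fun x hx =>
      (Submodule.eq_bot_iff _).1 h x (Submodule.subset_span hx)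
    rw [this, finrank_bot] at hV1
    exact zero_ne_one hV1
  · have : N = ⊤ := top_le_iff.1 fun x _ => hW (h ▸ Submodule.mem_top)
    subst this
    rw [Module.finrank_zero_of_subsingleton] at hN1
    exact zero_ne_one hN1

theorem IsObject.isSimpleModule {τ : SkewPairing k U A} {M : Type*} [AddCommGroup M] [Module k M]
    [Module τ.H M] [IsScalarTower k τ.H M] [FiniteDimensional k M]
    (hA : FiniteDimensionalIrreduciblesAreLines k A) (hM : τ.IsObject M)
    (huniq : ∃! V : Submodule k M, τ.IsASubmodule V ∧ Module.finrank k V = 1) :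
    IsSimpleModule τ.H M := by
  obtain ⟨V, hV, hV1, hgen⟩ := hM.exists_line
  have hnt : Nontrivial (Submodule τ.H M) := by
    rw [Submodule.nontrivial_iff]
    have : Nontrivial V := Module.nontrivial_of_finrank_pos (R := k) (by omega)
    exact V.subtype_injective.nontrivial
  refine (isSimpleModule_iff _ _).2 ⟨fun W => or_iff_not_imp_left.2 fun hW => ?_⟩
  -- The `A`-line found inside `W` must be the unique one of `M`, and that line generates `M`.
  obtain ⟨V', hle, hV', hV1'⟩ := τ.exists_line_le hA (W := W.restrictScalars k)
    (fun a x hx => W.smul_mem _ hx) (by rwa [Ne, Submodule.restrictScalars_eq_bot_iff])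
  obtain rfl := huniq.unique ⟨hV, hV1⟩ ⟨hV', hV1'⟩
  exact top_le_iff.1 (hgen ▸ Submodule.span_le.2 hle)

end Irreducible

/-! ### Uniqueness -/

section Uniqueness

variable {k U A : Type*} [Field k] [Ring U] [Bialgebra k U] [Ring A] [Bialgebra k A]
variable {τ : SkewPairing k U A}
variable {M : Type*} [AddCommGroup M] [Module k M] [Module τ.H M] [IsScalarTower k τ.H M]

theorem IsObject.existsUnique_line
    (hcomm : ∀ ρ ρ' : WithConv (U →ₐ[k] k), ρ * ρ' = ρ' * ρ)
    (hext : ∀ χ χ' : A →ₐ[k] k, (∀ g, IsGroupLikeElem k g → χ g = χ' g) → χ = χ')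
    (hM : τ.IsObject M) :
    ∃! V : Submodule k M, τ.IsASubmodule V ∧ Module.finrank k V = 1 := by
  obtain ⟨ρ, χ, m, f, h⟩ := hM.exists_hasWeights
  have key : ∀ V : Submodule k M, τ.IsASubmodule V ∧ Module.finrank k V = 1 → V = k ∙ m := by
    rintro V ⟨hV, hV1⟩
    obtain ⟨x, χ', hx0, rfl, hx⟩ := hV.exists_character hV1
    have e := (h.eq_smul_of_inclA_smul hcomm hext hx0 hx).2
    have hfx : f x ≠ 0 := fun h0 => hx0 (by rw [e, h0, zero_smul])
    rw [e]
    exact Submodule.span_singleton_smul_eq (IsUnit.mk0 _ hfx) m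
  obtain ⟨V, hV, hV1, -⟩ := hM.exists_line
  exact ⟨V, ⟨hV, hV1⟩, fun V' hV' => (key V' hV').trans (key V ⟨hV, hV1⟩).symm⟩

theorem IsObject.existsUnique_hyperplane
    (hcomm : ∀ χ χ' : WithConv (A →ₐ[k] k), χ * χ' = χ' * χ)
    (hext : ∀ ρ ρ' : U →ₐ[k] k, (∀ g, IsGroupLikeElem k g → ρ g = ρ' g) → ρ = ρ')
    (hM : τ.IsObject M) :
    ∃! N : Submodule k M, τ.IsUSubmodule N ∧ Module.finrank k (M ⧸ N) = 1 := by
  obtain ⟨ρ, χ, m, f, h⟩ := hM.exists_hasWeights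
  have key : ∀ N : Submodule k M, τ.IsUSubmodule N ∧ Module.finrank k (M ⧸ N) = 1 →
      N = LinearMap.ker f := by
    rintro N ⟨hN, hN1⟩
    obtain ⟨f', ρ', hf0, rfl, hf⟩ := hN.exists_character hN1
    obtain ⟨-, hfm, e⟩ := h.eq_smul_of_apply_inclU_smul hcomm hext hf0 hf
    rw [e, LinearMap.ker_smul _ _ hfm]
  obtain ⟨N, hN, hN1, -⟩ := hM.exists_hyperplane
  exact ⟨N, ⟨hN, hN1⟩, fun N' hN' => (key N' hN').trans (key N ⟨hN, hN1⟩).symm⟩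

theorem HasWeights.weights_eq
    (hcommU : ∀ ρ ρ' : WithConv (U →ₐ[k] k), ρ * ρ' = ρ' * ρ)
    (hextU : ∀ ρ ρ' : U →ₐ[k] k, (∀ g, IsGroupLikeElem k g → ρ g = ρ' g) → ρ = ρ')
    (hcommA : ∀ χ χ' : WithConv (A →ₐ[k] k), χ * χ' = χ' * χ)
    (hextA : ∀ χ χ' : A →ₐ[k] k, (∀ g, IsGroupLikeElem k g → χ g = χ' g) → χ = χ')
    {ρ ρ' : U →ₐ[k] k} {χ χ' : A →ₐ[k] k} {m m' : M} {f f' : M →ₗ[k] k}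
    (h : τ.HasWeights ρ χ m f) (h' : τ.HasWeights ρ' χ' m' f') : ρ' = ρ ∧ χ' = χ := by
  have hm' : m' ≠ 0 := fun h0 => one_ne_zero (α := k) (by rw [← h'.apply_eq_one, h0, map_zero])
  have hf' : f' ≠ 0 := fun h0 => one_ne_zero (α := k) (by
    rw [← h'.apply_eq_one, h0, LinearMap.zero_apply])
  exact ⟨(h.eq_smul_of_apply_inclU_smul hcommA hextU hf' h'.apply_inclU_smul).1,
    (h.eq_smul_of_inclA_smul hcommU hextA hm' h'.inclA_smul).1⟩

theorem IsObject.existsUnique_weights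
    (hcommU : ∀ ρ ρ' : WithConv (U →ₐ[k] k), ρ * ρ' = ρ' * ρ)
    (hextU : ∀ ρ ρ' : U →ₐ[k] k, (∀ g, IsGroupLikeElem k g → ρ g = ρ' g) → ρ = ρ')
    (hcommA : ∀ χ χ' : WithConv (A →ₐ[k] k), χ * χ' = χ' * χ)
    (hextA : ∀ χ χ' : A →ₐ[k] k, (∀ g, IsGroupLikeElem k g → χ g = χ' g) → χ = χ')
    (hM : τ.IsObject M) :
    ∃! p : (U →ₐ[k] k) × (A →ₐ[k] k), Nonempty (M ≃ₗ[τ.H] τ.L p.1 p.2) := by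
  obtain ⟨ρ, χ, m, f, h⟩ := hM.exists_hasWeights
  refine ⟨(ρ, χ), h.nonempty_equiv_L, ?_⟩
  rintro ⟨ρ', χ'⟩ ⟨e⟩
  -- The weights of `L(ρ', χ')` are carried over to `M`, where they must agree with `ρ` and `χ`.
  obtain ⟨h1, h2⟩ := h.weights_eq hcommU hextU hcommA hextA ((τ.hasWeights_L ρ' χ').map e.symm)
  exact Prod.ext h1 h2

variable (τ) in
open scoped ModuleCat in
theorem objectProperty_L (ρ : U →ₐ[k] k) (χ : A →ₐ[k] k) :
    τ.objectProperty (ModuleCat.of τ.H (τ.L ρ χ)) :=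
  -- Transport along the identity replaces the `k`-structure of `L` by the one that `ModuleCat`
  -- derives from the `H`-action.
  ((τ.hasWeights_L ρ χ).map (M' := ModuleCat.of τ.H (τ.L ρ χ)) (LinearEquiv.refl τ.H _)).isObject

end Uniqueness

open CategoryTheory in
open scoped ModuleCat in
theorem bijective_isoClass_L {k : Type*} [Field k] {U : Type u} [Ring U] [Bialgebra k U]
    {A : Type v} [Ring A] [Bialgebra k A] (τ : SkewPairing k U A)
    (hcommU : ∀ ρ ρ' : WithConv (U →ₐ[k] k), ρ * ρ' = ρ' * ρ)
    (hextU : ∀ ρ ρ' : U →ₐ[k] k, (∀ g, IsGroupLikeElem k g → ρ g = ρ' g) → ρ = ρ')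
    (hcommA : ∀ χ χ' : WithConv (A →ₐ[k] k), χ * χ' = χ' * χ)
    (hextA : ∀ χ χ' : A →ₐ[k] k, (∀ g, IsGroupLikeElem k g → χ g = χ' g) → χ = χ') :
    Function.Bijective (fun p : (U →ₐ[k] k) × (A →ₐ[k] k) =>
      (Quotient.mk _ ⟨ModuleCat.of τ.H (τ.L p.1 p.2), τ.objectProperty_L p.1 p.2⟩ :
        SkewPairing.IsoClasses.{u} τ)) := by
  have h : ∀ M : ModuleCat.{u} τ.H, τ.IsObject M →
      ∃! p : (U →ₐ[k] k) × (A →ₐ[k] k), Nonempty (M ≃ₗ[τ.H] τ.L p.1 p.2) :=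
    fun M hM => hM.existsUnique_weights hcommU hextU hcommA hextA
  constructor
  · intro p q hpq
    obtain ⟨e⟩ := Quotient.exact hpq
    exact (h (ModuleCat.of τ.H (τ.L p.1 p.2)) (τ.objectProperty_L p.1 p.2)).unique
      ⟨LinearEquiv.refl _ _⟩
      ⟨(((τ.objectProperty).ι.mapIso e).toLinearEquiv : τ.L p.1 p.2 ≃ₗ[τ.H] τ.L q.1 q.2)⟩
  · intro c
    induction c using Quotient.inductionOn with
    | h X =>
      obtain ⟨p, ⟨e⟩, -⟩ := h X.obj X.property
      exact ⟨p, Quotient.sound ⟨(ObjectProperty.isoMk _ e.toModuleIso).symm⟩⟩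

end SkewPairing
end

/-! ### The main theorem -/

theorem mainTheorem6 {k : Type*} [Field k] [IsAlgClosed k] [CharZero k]
    {U : Type u} [Ring U] [HopfAlgebra k U] {A : Type v} [Ring A] [HopfAlgebra k A]
    (hU : HopfSub.IsPointed k U) (hA : HopfSub.IsPointed k A)
    (hU₀ : HopfSub.HasCommutativeCoradical k U) (hA₀ : HopfSub.HasCommutativeCoradical k A)
    (hUgen : HopfSub.GeneratedByFiniteTypeSkewPrimitives k U)
    (hAgen : HopfSub.GeneratedByFiniteTypeSkewPrimitives k A)
    (τ : SkewPairing k U A) :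
    -- `Alg(U, k)` and `Alg(A, k)` are abelian groups under convolution
    ((∀ ρ : WithConv (U →ₐ[k] k), IsUnit ρ) ∧
      (∀ ρ ρ' : WithConv (U →ₐ[k] k), ρ * ρ' = ρ' * ρ)) ∧
    ((∀ χ : WithConv (A →ₐ[k] k), IsUnit χ) ∧
      (∀ χ χ' : WithConv (A →ₐ[k] k), χ * χ' = χ' * χ)) ∧
    -- a) the `L(ρ, χ)` are objects, and `(ρ, χ) ↦ [L(ρ, χ)]` is a bijection onto `[ₕM]`
    (∃ hL : ∀ (ρ : U →ₐ[k] k) (χ : A →ₐ[k] k), τ.objectProperty (ModuleCat.of τ.H (τ.L ρ χ)),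
      Function.Bijective (fun p : (U →ₐ[k] k) × (A →ₐ[k] k) =>
        (Quotient.mk _ ⟨ModuleCat.of τ.H (τ.L p.1 p.2), hL p.1 p.2⟩ :
          SkewPairing.IsoClasses.{u} τ))) ∧
    -- a) for objects in an arbitrary universe
    (∀ (M : Type w) [AddCommGroup M] [Module k M] [Module τ.H M] [IsScalarTower k τ.H M],
      τ.IsObject M →
        ∃! p : (U →ₐ[k] k) × (A →ₐ[k] k), Nonempty (M ≃ₗ[τ.H] τ.L p.1 p.2)) ∧
    -- b) uniqueness of the line and of the hyperplane
    (∀ (M : Type w) [AddCommGroup M] [Module k M] [Module τ.H M] [IsScalarTower k τ.H M],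
      τ.IsObject M →
        (∃! V : Submodule k M, τ.IsASubmodule V ∧ Module.finrank k V = 1) ∧
        (∃! N : Submodule k M, τ.IsUSubmodule N ∧ Module.finrank k (M ⧸ N) = 1)) ∧
    -- c) finite-dimensional irreducible `H`-modules
    (FiniteDimensionalIrreduciblesAreLines k U → FiniteDimensionalIrreduciblesAreLines k A →
      ∀ (M : Type w) [AddCommGroup M] [Module k M] [Module τ.H M] [IsScalarTower k τ.H M]
        [FiniteDimensional k M], IsSimpleModule τ.H M ↔ τ.IsObject M) := by
  have commU := HopfSub.conv_comm hU hU₀ hUgen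
  have commA := HopfSub.conv_comm hA hA₀ hAgen
  have extU : ∀ ρ ρ' : U →ₐ[k] k, (∀ g, IsGroupLikeElem k g → ρ g = ρ' g) → ρ = ρ' :=
    fun _ _ => HopfSub.algHom_ext_of_isGroupLikeElem hU hU₀ hUgen
  have extA : ∀ χ χ' : A →ₐ[k] k, (∀ g, IsGroupLikeElem k g → χ g = χ' g) → χ = χ' :=
    fun _ _ => HopfSub.algHom_ext_of_isGroupLikeElem hA hA₀ hAgen
  refine ⟨⟨HopfSub.isUnit_conv, commU⟩, ⟨HopfSub.isUnit_conv, commA⟩,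
    ⟨τ.objectProperty_L, τ.bijective_isoClass_L commU extU commA extA⟩,
    fun M _ _ _ _ hM => hM.existsUnique_weights commU extU commA extA,
    fun M _ _ _ _ hM => ⟨hM.existsUnique_line commU extA, hM.existsUnique_hyperplane commA extU⟩,
    fun hUl hAl M _ _ _ _ _ => ⟨fun _ => τ.isObject_of_isSimpleModule hUl hAl,
      fun hM => hM.isSimpleModule hAl (hM.existsUnique_line commU extA)⟩⟩
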